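/- Let $k$ be an infinite field and let $S = k[x_1,\dots,x_n]$ with its standard grading. All ideals of $S$ below are assumed homogeneous and proper. Definitions. The depth of an ideal $I$ is the maximal length of an $S$-regular sequence contained in $I$. We say that $I$ *minimally contains an $(a_1,\dots,a_r)$-regular sequence of forms* if $I$ has depth $r$, $a_1$ is the minimum degree of the nonzero forms in $I$ (when $r\ge 1$), and for each $2\le i\le r$ the integer $a_i$ is the smallest degree such that $I$ contains an $S$-regular sequence $f_1,\dots,f_i$ of forms of degrees $a_1,\dots,a_i$ respectively. A *complete intersection (CI) ideal* is an ideal generated by an $S$-regular sequence of forms $f_1,\dots,f_r$; if $\deg f_1\le\dots\le\deg f_r$, its *type* is $(\deg f_1,\dots,\deg f_r)$. Ideals $I, I'$ of height $r$ are *directly linked* by a CI ideal $J$ of height $r$ if $J\subseteq I\cap I'$, $I=J:I'$ and $I'=J:I$; this is a *minimal* link from $I$ to $I'$ if moreover $J$ has type $(a_1,\dots,a_r)$, where $I$ minimally contains an $(a_1,\dots,a_r)$-regular sequence of forms. An ideal $I$ of height $r$ is *minimally licci* if there are $s\ge 0$ and ideals $I=I_0,I_1,\dots,I_s$ of height $r$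 such that $I_s$ is a CI ideal and for each $1\le i\le s$ there is a minimal link from $I_{i-1}$ to $I_i$. (The case $s=0$ says that a CI ideal is minimally licci.) The Hilbert function of an ideal $I$ is $d\mapsto \dim_k (S/I)_d$. A monomial ideal is an ideal generated by monomials. Statement. Let $2\le e_1\le\dots\le e_n$ be integers. If $I\subset S$ is a minimally licci ideal that minimally contains an $(e_1,\dots,e_n)$-regular sequence of forms, then there exists a monomial ideal $J\subsetneq S$ containing $x_1^{e_1},\dots,x_n^{e_n}$ that has the same Hilbert function as $I$. -/

import Mathlib

namespace Liaison

open MvPolynomial RingTheory.Sequence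

section Ring

variable {R : Type*} [CommRing R]

/-- The depth of an ideal `I` of `R`: the supremum of the lengths of the `R`-regular sequences
contained in `I`. -/
noncomputable def depth (I : Ideal R) : ℕ∞ :=
  ⨆ (fs : List R) (_ : IsRegular R fs ∧ ∀ f ∈ fs, f ∈ I), (fs.length : ℕ∞)

end Ring

section Polynomial

variable {k : Type*} [Field k] {n : ℕ}

/-- `fs` is an `S`-regular sequence of forms whose degrees are the entries of `a`, in this order,
where `S = k[x₁, …, xₙ]`. -/
def IsRegularSeqOfForms (fs : List (MvPolynomial (Fin n) k)) (a : List ℕ) : Prop :=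
  IsRegular (MvPolynomial (Fin n) k) fs ∧ List.Forall₂ (fun f d => f.IsHomogeneous d) fs a

/-- `I` contains an `S`-regular sequence of forms of degrees `a`. -/
def ContainsRegularSeq (I : Ideal (MvPolynomial (Fin n) k)) (a : List ℕ) : Prop :=
  ∃ fs, IsRegularSeqOfForms fs a ∧ ∀ f ∈ fs, f ∈ I

/-- `I` minimally contains an `(a₁, …, a_r)`-regular sequence of forms. The indices of the list `a`
start at `0`, so that `a[i]` is `a_{i+1}` and `a.take i` is `(a₁, …, a_i)`. -/
structure MinimallyContains (I : Ideal (MvPolynomial (Fin n) k)) (a : List ℕ) : Prop where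
  depth_eq : depth I = (a.length : ℕ∞)
  first : ∀ h : 0 < a.length,
    IsLeast {d : ℕ | ∃ f ∈ I, f ≠ 0 ∧ f.IsHomogeneous d} (a[0]'h)
  next : ∀ (i : ℕ) (h : i < a.length), 1 ≤ i →
    IsLeast {d : ℕ | ContainsRegularSeq I (a.take i ++ [d])} (a[i]'h)

/-- `J` is a complete intersection ideal: it is generated by an `S`-regular sequence of forms. -/
def IsCI (J : Ideal (MvPolynomial (Fin n) k)) : Prop :=
  ∃ fs a, IsRegularSeqOfForms fs a ∧ J = Ideal.ofList fs

/-- `J` is a complete intersection ideal of type `a`. -/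
def IsCIOfType (J : Ideal (MvPolynomial (Fin n) k)) (a : List ℕ) : Prop :=
  a.Pairwise (· ≤ ·) ∧ ∃ fs, IsRegularSeqOfForms fs a ∧ J = Ideal.ofList fs

section Homogeneous

attribute [local instance] MvPolynomial.gradedAlgebra

/-- `I` is a proper homogeneous ideal (for the standard grading) of height `r`. -/
def IsProperHomogeneousOfHeight (r : ℕ) (I : Ideal (MvPolynomial (Fin n) k)) : Prop :=
  I ≠ ⊤ ∧ I.IsHomogeneous (homogeneousSubmodule (Fin n) k) ∧ I.height = (r : ℕ∞)

end Homogeneous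

/-- The ideals `I` and `I'` of height `r` are directly linked by `J`. -/
structure DirectlyLinked (r : ℕ) (J I I' : Ideal (MvPolynomial (Fin n) k)) : Prop where
  left : IsProperHomogeneousOfHeight r I
  right : IsProperHomogeneousOfHeight r I'
  isCI : IsCI J
  height_link : J.height = (r : ℕ∞)
  le : J ≤ I ⊓ I'
  left_eq : I = Submodule.colon J (I' : Set (MvPolynomial (Fin n) k))
  right_eq : I' = Submodule.colon J (I : Set (MvPolynomial (Fin n) k))

/-- `J` is a minimal link from `I` to `I'`: the two ideals are directly linked by `J`, and the type
of `J` is the tuple `(a₁, …, a_r)` such that `I` minimally contains an `(a₁, …, a_r)`-regular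
sequence of forms. -/
def IsMinimalLink (r : ℕ) (J I I' : Ideal (MvPolynomial (Fin n) k)) : Prop :=
  DirectlyLinked r J I I' ∧
    ∃ a : List ℕ, a.length = r ∧ MinimallyContains I a ∧ IsCIOfType J a

/-- `I` is minimally linked to `I'`, both of height `r`: there is a finite sequence of ideals
`I = I₀, I₁, …, I_s = I'` of height `r`, each of which is linked to the next by a minimal link.
The length `s = 0` is allowed, so that every ideal is minimally linked to itself. -/
def IsMinimallyLinked (r : ℕ) (I I' : Ideal (MvPolynomial (Fin n) k)) : Prop :=
  ∃ (s : ℕ) (L : ℕ → Ideal (MvPolynomial (Fin n) k)), L 0 = I ∧ L s = I' ∧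
    (∀ i ≤ s, IsProperHomogeneousOfHeight r (L i)) ∧
    ∀ i < s, ∃ J, IsMinimalLink r J (L i) (L (i + 1))

/-- `I` is minimally licci: it is minimally linked to a complete intersection ideal. -/
def IsMinimallyLicci (I : Ideal (MvPolynomial (Fin n) k)) : Prop :=
  ∃ (r : ℕ) (C : Ideal (MvPolynomial (Fin n) k)), IsCI C ∧ IsMinimallyLinked r I C

/-- The Hilbert function `d ↦ dim_k (S/I)_d` of a homogeneous ideal `I`; here `(S/I)_d` is the image
in `S/I` of the space of forms of degree `d`. -/
noncomputable def hilbertFunction (I : Ideal (MvPolynomial (Fin n) k)) (d : ℕ) : ℕ :=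
  Module.finrank k
    ((homogeneousSubmodule (Fin n) k d).map (Ideal.Quotient.mkₐ k I).toLinearMap)

/-- `J` is a monomial ideal: it is generated by a set of monomials. -/
def IsMonomialIdeal (J : Ideal (MvPolynomial (Fin n) k)) : Prop :=
  ∃ A : Set (Fin n →₀ ℕ), J = Ideal.span ((fun m => monomial m (1 : k)) '' A)

end Polynomial

end Liaison

open RingTheory.Sequence Submodule Pointwise in
/-- Two elements of `K` that are regular on `M` have isomorphic `K`-torsion in the quotients. -/
theorem torsionBySet_quotSMulTop_equiv {R M : Type*} [CommRing R] [AddCommGroup M] [Module R M]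
    {K : Ideal R} {x y : R} (hxK : x ∈ K) (hyK : y ∈ K)
    (hx : IsSMulRegular M x) (hy : IsSMulRegular M y) :
    Nonempty (torsionBySet R (QuotSMulTop x M) (K : Set R) ≃ₗ[R]
      torsionBySet R (QuotSMulTop y M) (K : Set R)) := by
  let T : Submodule R (M × M) :=
    { carrier := {p | y • p.1 = x • p.2 ∧ ∀ a ∈ K, a • p.1 ∈ x • (⊤ : Submodule R M)}
      add_mem' := fun {p q} hp hq => ⟨by simp [smul_add, hp.1, hq.1], fun a ha => by
        simpa [smul_add] using add_mem (hp.2 a ha) (hq.2 a ha)⟩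
      zero_mem' := by simp
      smul_mem' := fun c p hp => ⟨by
        simp only [Prod.smul_fst, Prod.smul_snd]
        rw [smul_comm, hp.1, smul_comm], fun a ha => by
        rw [Prod.smul_fst, smul_comm]
        exact Submodule.smul_mem _ _ (hp.2 a ha)⟩ }
  have hT2 : ∀ p ∈ T, ∀ a ∈ K, a • p.2 ∈ y • (⊤ : Submodule R M) := by
    rintro ⟨u, v⟩ ⟨h1, h2⟩ a ha
    obtain ⟨w, -, hw⟩ := (mem_smul_pointwise_iff_exists _ _ _).1 (h2 a ha)
    refine (mem_smul_pointwise_iff_exists _ _ _).2 ⟨w, trivial, hx ?_⟩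
    simp only at h1 hw ⊢
    rw [smul_comm, hw, smul_comm, h1, smul_comm]
  let p1 : T →ₗ[R] torsionBySet R (QuotSMulTop x M) (K : Set R) :=
    LinearMap.codRestrict _ ((mkQ _).comp ((LinearMap.fst R M M).comp T.subtype)) (fun p => by
      rw [mem_torsionBySet_iff]
      rintro ⟨a, ha⟩
      exact (Submodule.Quotient.mk_eq_zero _).2 (p.2.2 a ha))
  let p2 : T →ₗ[R] torsionBySet R (QuotSMulTop y M) (K : Set R) :=
    LinearMap.codRestrict _ ((mkQ _).comp ((LinearMap.snd R M M).comp T.subtype)) (fun p => by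
      rw [mem_torsionBySet_iff]
      rintro ⟨a, ha⟩
      exact (Submodule.Quotient.mk_eq_zero _).2 (hT2 p p.2 a ha))
  have hp1 : Function.Surjective p1 := by
    rintro ⟨q, hq⟩
    obtain ⟨u, rfl⟩ := mkQ_surjective _ q
    rw [mem_torsionBySet_iff] at hq
    have hu : ∀ a ∈ K, a • u ∈ x • (⊤ : Submodule R M) := fun a ha =>
      (Submodule.Quotient.mk_eq_zero _).1 (hq ⟨a, ha⟩)
    obtain ⟨v, -, hv⟩ := (mem_smul_pointwise_iff_exists _ _ _).1 (hu y hyK)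
    exact ⟨⟨(u, v), hv.symm, hu⟩, rfl⟩
  have hp2 : Function.Surjective p2 := by
    rintro ⟨q, hq⟩
    obtain ⟨v, rfl⟩ := mkQ_surjective _ q
    rw [mem_torsionBySet_iff] at hq
    have hv : ∀ a ∈ K, a • v ∈ y • (⊤ : Submodule R M) := fun a ha =>
      (Submodule.Quotient.mk_eq_zero _).1 (hq ⟨a, ha⟩)
    obtain ⟨u, -, hu⟩ := (mem_smul_pointwise_iff_exists _ _ _).1 (hv x hxK)
    refine ⟨⟨(u, v), hu, fun a ha => ?_⟩, rfl⟩
    obtain ⟨w, -, hw⟩ := (mem_smul_pointwise_iff_exists _ _ _).1 (hv a ha)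
    refine (mem_smul_pointwise_iff_exists _ _ _).2 ⟨w, trivial, hy ?_⟩
    simp only at hu hw ⊢
    rw [smul_comm, hw, smul_comm, ← hu, smul_comm]
  have hker : LinearMap.ker p1 = LinearMap.ker p2 := by
    ext ⟨⟨u, v⟩, h, hK⟩
    simp only [LinearMap.mem_ker]
    have e1 : p1 ⟨(u, v), h, hK⟩ = 0 ↔ u ∈ x • (⊤ : Submodule R M) :=
      Subtype.ext_iff.trans (Submodule.Quotient.mk_eq_zero _)
    have e2 : p2 ⟨(u, v), h, hK⟩ = 0 ↔ v ∈ y • (⊤ : Submodule R M) :=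
      Subtype.ext_iff.trans (Submodule.Quotient.mk_eq_zero _)
    rw [e1, e2]
    simp only at h
    constructor
    · intro hu
      obtain ⟨w, -, rfl⟩ := (mem_smul_pointwise_iff_exists _ _ _).1 hu
      refine (mem_smul_pointwise_iff_exists _ _ _).2 ⟨w, trivial, hx ?_⟩
      simp only
      rw [← h, smul_comm]
    · intro hv
      obtain ⟨w, -, rfl⟩ := (mem_smul_pointwise_iff_exists _ _ _).1 hv
      refine (mem_smul_pointwise_iff_exists _ _ _).2 ⟨w, trivial, hy ?_⟩
      simp only
      rw [h, smul_comm]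
  exact ⟨(p1.quotKerEquivOfSurjective hp1).symm ≪≫ₗ quotEquivOfEq _ _ hker ≪≫ₗ
    p2.quotKerEquivOfSurjective hp2⟩

open Submodule in
/-- Linearly equivalent modules have linearly equivalent torsion. -/
theorem LinearEquiv.nonempty_torsionBySet {R M N : Type*} [CommRing R] [AddCommGroup M]
    [Module R M] [AddCommGroup N] [Module R N] (e : M ≃ₗ[R] N) (s : Set R) :
    Nonempty (torsionBySet R M s ≃ₗ[R] torsionBySet R N s) := by
  refine ⟨e.ofSubmodules _ _ ?_⟩
  ext y
  simp only [Submodule.mem_map, mem_torsionBySet_iff]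
  constructor
  · rintro ⟨x, hx, rfl⟩ a
    simpa using congrArg e (hx a)
  · intro hy
    exact ⟨e.symm y, fun a => by simpa using congrArg e.symm (hy a), by simp⟩

/-- Prime avoidance: an ideal contained in none of finitely many primes has an element outside all
of them. -/
theorem Ideal.exists_mem_forall_notMem_of_finite {R : Type*} [CommRing R] {K : Ideal R}
    {P : Set (Ideal R)} (hfin : P.Finite) (hprime : ∀ p ∈ P, p.IsPrime) (hK : ∀ p ∈ P, ¬ K ≤ p) :
    ∃ z ∈ K, ∀ p ∈ P, z ∉ p := by
  by_contra! h
  have : (K : Set R) ⊆ ⋃ p ∈ P, (id p : Ideal R) := fun z hz => by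
    obtain ⟨p, hp, hzp⟩ := h z hz
    exact Set.mem_biUnion hp hzp
  obtain ⟨p, hp, hle⟩ := (Ideal.subset_union_prime_finite hfin (f := id) ⊥ ⊥
    (fun p hp _ _ => hprime p hp)).1 this
  exact hK p hp hle

theorem isSMulRegular_of_forall_associatedPrimes {R M : Type*} [CommRing R] [IsNoetherianRing R]
    [AddCommGroup M] [Module R M] {z : R} (h : ∀ p ∈ associatedPrimes R M, z ∉ p) :
    IsSMulRegular M z := by
  by_contra hz
  have : z ∈ ⋃ p ∈ associatedPrimes R M, (p : Set R) := by
    rw [biUnion_associatedPrimes_eq_compl_regular R M]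
    exact hz
  simp only [Set.mem_iUnion] at this
  obtain ⟨p, hp, hzp⟩ := this
  exact h p hp hzp

theorem IsSMulRegular.notMem_of_mem_associatedPrimes {R M : Type*} [CommRing R]
    [IsNoetherianRing R] [AddCommGroup M] [Module R M] {z : R} (h : IsSMulRegular M z)
    {p : Ideal R} (hp : p ∈ associatedPrimes R M) : z ∉ p := by
  intro hz
  have : z ∈ ⋃ p ∈ associatedPrimes R M, (p : Set R) := Set.mem_biUnion hp hz
  rw [biUnion_associatedPrimes_eq_compl_regular R M] at this
  exact this h

open scoped Pointwise in
theorem IsSMulRegular.swap_quotSMulTop {R M : Type*} [CommRing R] [AddCommGroup M] [Module R M]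
    {x z : R} (hx : IsSMulRegular M x) (hz : IsSMulRegular (QuotSMulTop x M) z) :
    IsSMulRegular (QuotSMulTop z M) x := by
  rw [isSMulRegular_quotient_iff_mem_of_smul_mem] at hz ⊢
  intro m hm
  obtain ⟨n, -, hn⟩ := (Submodule.mem_smul_pointwise_iff_exists _ _ _).1 hm
  have h1 := hz n (by
    exact hn.symm ▸ Submodule.smul_mem_pointwise_smul _ _ _ trivial)
  obtain ⟨n', -, rfl⟩ := (Submodule.mem_smul_pointwise_iff_exists _ _ _).1 h1
  refine (Submodule.mem_smul_pointwise_iff_exists _ _ _).2 ⟨n', trivial, hx ?_⟩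
  simp only at hn ⊢
  rw [← hn, smul_comm]

namespace RingTheory.Sequence

open Submodule

theorem ofList_eq_of_perm {R : Type*} [CommRing R] {l l' : List R} (h : l.Perm l') :
    Ideal.ofList l = Ideal.ofList l' :=
  congrArg Ideal.span (Set.ext fun _ => h.mem_iff)

theorem isWeaklyRegular_cons_of_forall_take {R : Type*} [CommRing R] (xs : List R) (z : R) :
    ∀ {M : Type*} [AddCommGroup M] [Module R M], IsWeaklyRegular M xs →
    (∀ j ≤ xs.length, IsSMulRegular (M ⧸ (Ideal.ofList (xs.take j) • ⊤ : Submodule R M)) z) →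
    IsWeaklyRegular M (z :: xs) := by
  induction xs with
  | nil =>
    intro M _ _ _ hz
    rw [isWeaklyRegular_singleton_iff]
    have h0 := hz 0 le_rfl
    exact ((quotEquivOfEqBot _ (by simp)).isSMulRegular_congr z).1 h0
  | cons x xs ih =>
    intro M _ _ hxs hz
    rw [isWeaklyRegular_cons_iff] at hxs
    have hzM : IsSMulRegular M z :=
      ((quotEquivOfEqBot _ (by simp)).isSMulRegular_congr z).1 (hz 0 (Nat.zero_le _))
    have h1 : IsWeaklyRegular (QuotSMulTop x M) (z :: xs) := by
      refine ih hxs.2 fun j hj => ?_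
      exact ((quotOfListConsSMulTopEquivQuotSMulTopInner M x (xs.take j)).isSMulRegular_congr z).1
        (hz (j + 1) (by simpa using hj))
    have h2 : IsWeaklyRegular M ([x, z] ++ xs) := h1.cons hxs.1
    rw [show z :: x :: xs = [z, x] ++ xs from rfl, isWeaklyRegular_append_iff]
    rw [isWeaklyRegular_append_iff] at h2
    refine ⟨?_, ?_⟩
    · rw [isWeaklyRegular_cons_iff, isWeaklyRegular_singleton_iff]
      exact ⟨hzM, hxs.1.swap_quotSMulTop ((isWeaklyRegular_cons_iff _ _ _).1 h1).1⟩
    · rw [(quotEquivOfEq _ _ (congrArg₂ _ (ofList_eq_of_perm (List.Perm.swap x z [])) rfl)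
        ).isWeaklyRegular_congr]
      exact h2.2

/-- The `K`-torsion of `M / (xs) M` does not depend on the `M`-regular sequence `xs` in `K`, but
only on its length. -/
theorem nonempty_torsionBySet_quotient_equiv {R : Type*} [CommRing R] [IsNoetherianRing R]
    {K : Ideal R} (r : ℕ) : ∀ {M : Type*} [AddCommGroup M] [Module R M] [Module.Finite R M]
    {xs ys : List R}, xs.length = r → ys.length = r →
    IsWeaklyRegular M xs → IsWeaklyRegular M ys → (∀ x ∈ xs, x ∈ K) → (∀ y ∈ ys, y ∈ K) →
    Nonempty (torsionBySet R (M ⧸ (Ideal.ofList xs • ⊤ : Submodule R M)) (K : Set R) ≃ₗ[R]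
      torsionBySet R (M ⧸ (Ideal.ofList ys • ⊤ : Submodule R M)) (K : Set R)) := by
  induction r with
  | zero =>
    intro M _ _ _ xs ys hx hy _ _ _ _
    rw [List.length_eq_zero_iff] at hx hy
    subst hx hy
    exact ⟨LinearEquiv.refl _ _⟩
  | succ r ih =>
    intro M _ _ _ xs ys hxl hyl hxs hys hxK hyK
    obtain ⟨z, hzK, hz⟩ := Ideal.exists_mem_forall_notMem_of_finite (K := K)
      (P := (⋃ j ∈ Finset.range (r + 1),
          associatedPrimes R (M ⧸ (Ideal.ofList (xs.take j) • ⊤ : Submodule R M))) ∪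
        ⋃ j ∈ Finset.range (r + 1),
          associatedPrimes R (M ⧸ (Ideal.ofList (ys.take j) • ⊤ : Submodule R M)))
      (Set.Finite.union
        (Set.Finite.biUnion (Finset.finite_toSet _) fun _ _ => associatedPrimes.finite R _)
        (Set.Finite.biUnion (Finset.finite_toSet _) fun _ _ => associatedPrimes.finite R _))
      (by
        intro p hp
        simp only [Set.mem_union, Set.mem_iUnion] at hp
        obtain ⟨_, _, hp⟩ | ⟨_, _, hp⟩ := hp <;> exact IsAssociatedPrime.isPrime hp)
      (by
        intro p hp hle
        simp only [Set.mem_union, Set.mem_iUnion, Finset.mem_range] at hp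
        obtain ⟨j, hj, hp⟩ | ⟨j, hj, hp⟩ := hp
        · exact (hxs.regular_mod_prev j (by omega)).notMem_of_mem_associatedPrimes hp
            (hle (hxK _ (List.getElem_mem _)))
        · exact (hys.regular_mod_prev j (by omega)).notMem_of_mem_associatedPrimes hp
            (hle (hyK _ (List.getElem_mem _))))
    have key : ∀ ws : List R, ws.length = r + 1 → IsWeaklyRegular M ws → (∀ x ∈ ws, x ∈ K) →
        (∀ j ≤ r, IsSMulRegular (M ⧸ (Ideal.ofList (ws.take j) • ⊤ : Submodule R M)) z) →
        IsWeaklyRegular (QuotSMulTop z M) (ws.take r) ∧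
        Nonempty (torsionBySet R (M ⧸ (Ideal.ofList ws • ⊤ : Submodule R M)) (K : Set R) ≃ₗ[R]
          torsionBySet R (QuotSMulTop z M ⧸
            (Ideal.ofList (ws.take r) • ⊤ : Submodule R (QuotSMulTop z M))) (K : Set R)) := by
      intro ws hl hws hwK hreg
      have hlt : r < ws.length := by omega
      have happ : ws = ws.take r ++ [ws[r]] := by
        rw [← List.take_succ_eq_append_getElem hlt, List.take_of_length_le (by omega)]
      have hw' : IsWeaklyRegular M (ws.take r) := by
        rw [happ, isWeaklyRegular_append_iff] at hws
        exact hws.1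
      constructor
      · refine ((isWeaklyRegular_cons_iff _ _ _).1
          (isWeaklyRegular_cons_of_forall_take (ws.take r) z hw' fun j hj => ?_)).2
        have : j ≤ r := by simp at hj; omega
        rw [List.take_take, min_eq_left this]
        exact hreg j this
      · have e0 : Ideal.ofList ws = Ideal.ofList (ws[r] :: ws.take r) := by
          conv_lhs => rw [happ]
          exact ofList_eq_of_perm (List.perm_append_comm)
        obtain ⟨e1⟩ := (quotEquivOfEq _ _ (congrArg (· • (⊤ : Submodule R M)) e0) ≪≫ₗ
          quotOfListConsSMulTopEquivQuotSMulTopOuter M ws[r] (ws.take r)).nonempty_torsionBySet K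
        obtain ⟨e2⟩ := torsionBySet_quotSMulTop_equiv (K := K)
          (hwK _ (List.getElem_mem hlt)) hzK (hws.regular_mod_prev r hlt) (hreg r le_rfl)
        obtain ⟨e3⟩ := ((quotOfListConsSMulTopEquivQuotSMulTopOuter M z (ws.take r)).symm ≪≫ₗ
          quotOfListConsSMulTopEquivQuotSMulTopInner M z (ws.take r)).nonempty_torsionBySet K
        exact ⟨e1 ≪≫ₗ e2 ≪≫ₗ e3⟩
    obtain ⟨hx1, ⟨ex⟩⟩ := key xs hxl hxs hxK fun j hj =>
      isSMulRegular_of_forall_associatedPrimes fun p hp => hz p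
        (Or.inl (Set.mem_biUnion (Finset.mem_coe.2 (Finset.mem_range.2 (Nat.lt_succ_of_le hj))) hp))
    obtain ⟨hy1, ⟨ey⟩⟩ := key ys hyl hys hyK fun j hj =>
      isSMulRegular_of_forall_associatedPrimes fun p hp => hz p
        (Or.inr (Set.mem_biUnion (Finset.mem_coe.2 (Finset.mem_range.2 (Nat.lt_succ_of_le hj))) hp))
    obtain ⟨e⟩ := ih (M := QuotSMulTop z M) (xs := xs.take r) (ys := ys.take r)
      (by simp [hxl]) (by simp [hyl]) hx1 hy1
      (fun x hx => hxK x (List.mem_of_mem_take hx)) (fun x hx => hyK x (List.mem_of_mem_take hx))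
    exact ⟨ex ≪≫ₗ e ≪≫ₗ ey.symm⟩

/-- A weakly regular sequence shorter than another one, both in `K`, has no `K`-torsion in the
quotient. -/
theorem torsionBySet_quotient_eq_bot {R : Type*} [CommRing R] [IsNoetherianRing R]
    {K : Ideal R} {M : Type*} [AddCommGroup M] [Module R M] [Module.Finite R M]
    {xs ys : List R} (hlt : xs.length < ys.length)
    (hx : IsWeaklyRegular M xs) (hy : IsWeaklyRegular M ys)
    (hxK : ∀ x ∈ xs, x ∈ K) (hyK : ∀ y ∈ ys, y ∈ K) :
    torsionBySet R (M ⧸ (Ideal.ofList xs • ⊤ : Submodule R M)) (K : Set R) = ⊥ := by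
  have hy' : IsWeaklyRegular M (ys.take xs.length) := by
    rw [← List.take_append_drop xs.length ys, isWeaklyRegular_append_iff] at hy
    exact hy.1
  obtain ⟨e⟩ := nonempty_torsionBySet_quotient_equiv (K := K) xs.length rfl
    (by simp; omega) hx hy' hxK (fun y hy => hyK y (List.mem_of_mem_take hy))
  have hreg := hy.regular_mod_prev _ hlt
  rw [eq_bot_iff]
  intro u hu
  have h0 : e ⟨u, hu⟩ = 0 := by
    apply Subtype.ext
    have h1 := (mem_torsionBySet_iff _ _).1 (e ⟨u, hu⟩).2 ⟨_, hyK _ (List.getElem_mem hlt)⟩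
    exact hreg (by simpa using h1)
  simpa using h0

end RingTheory.Sequence

open RingTheory.Sequence in
/-- A weakly regular sequence in an ideal is at most as long as the height of the ideal. -/
theorem Ideal.length_le_height_of_isWeaklyRegular {R : Type*} [CommRing R] [IsNoetherianRing R]
    {I : Ideal R} {rs : List R} (h : IsWeaklyRegular R rs) (hI : ∀ r ∈ rs, r ∈ I) :
    (rs.length : ℕ∞) ≤ I.height := by
  rw [Ideal.height_eq_inf_minimalPrimes]
  refine le_iInf₂ fun p hp => ?_
  have := hp.1.1
  have hreg := h.isRegular_of_isLocalization_of_mem (Localization.AtPrime p) p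
    (fun r hr => hp.1.2 (hI r hr))
  have h1 := ringKrullDim_add_length_eq_ringKrullDim_of_isRegular _ hreg
  rw [IsLocalization.AtPrime.ringKrullDim_eq_height p (Localization.AtPrime p), List.length_map] at h1
  have : Nontrivial (Localization.AtPrime p ⧸
      Ideal.ofList (rs.map (algebraMap R (Localization.AtPrime p)))) :=
    Ideal.Quotient.nontrivial_iff.2 fun hh => hreg.2 (by simp [hh])
  have h2 : (0 : WithBot ℕ∞) ≤ ringKrullDim (Localization.AtPrime p ⧸
      Ideal.ofList (rs.map (algebraMap R (Localization.AtPrime p)))) := ringKrullDim_nonneg_of_nontrivial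
  have h3 : ((rs.length : ℕ∞) : WithBot ℕ∞) ≤ (p.height : WithBot ℕ∞) := by
    rw [← h1]
    exact le_add_of_nonneg_left h2
  exact_mod_cast h3

namespace RingTheory.Sequence

variable {R : Type*} [CommRing R]

theorem isRegular_self_iff {rs : List R} :
    IsRegular R rs ↔ IsWeaklyRegular R rs ∧ Ideal.ofList rs ≠ ⊤ := by
  rw [isRegular_iff, smul_eq_mul, Ideal.mul_top, ne_comm]

theorem isSMulRegular_quotient_ofList_iff {rs : List R} {r : R} :
    IsSMulRegular (R ⧸ (Ideal.ofList rs • ⊤ : Submodule R R)) r ↔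
      ∀ g, r * g ∈ Ideal.ofList rs → g ∈ Ideal.ofList rs := by
  rw [isSMulRegular_quotient_iff_mem_of_smul_mem, smul_eq_mul, Ideal.mul_top]
  rfl

theorem isWeaklyRegular_append_singleton_iff {rs : List R} {r : R} :
    IsWeaklyRegular R (rs ++ [r]) ↔
      IsWeaklyRegular R rs ∧ ∀ g, r * g ∈ Ideal.ofList rs → g ∈ Ideal.ofList rs := by
  rw [isWeaklyRegular_append_iff, isWeaklyRegular_singleton_iff, isSMulRegular_quotient_ofList_iff]

theorem IsRegular.of_append_left {rs rs' : List R} (h : IsRegular R (rs ++ rs')) :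
    IsRegular R rs := by
  rw [isRegular_self_iff] at h ⊢
  refine ⟨((isWeaklyRegular_append_iff _ _ _).1 h.1).1, fun h' => h.2 ?_⟩
  rw [Ideal.ofList_append, h', top_sup_eq]

theorem IsRegular.zero_notMem {rs : List R} (h : IsRegular R rs) : (0 : R) ∉ rs := by
  intro h0
  obtain ⟨i, hi, h0⟩ := List.getElem_of_mem h0
  have hreg := h.regular_mod_prev i hi
  rw [h0, isSMulRegular_quotient_ofList_iff] at hreg
  refine (isRegular_self_iff.1 h).2 (top_unique ?_)
  have : Ideal.ofList (rs.take i) ≤ Ideal.ofList rs :=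
    Ideal.span_mono fun x hx => List.mem_of_mem_take hx
  exact le_trans (fun g _ => hreg g (by simp)) this

end RingTheory.Sequence

namespace MvPolynomial

section

variable {σ R : Type*} [CommRing R]

attribute [local instance] MvPolynomial.gradedAlgebra

theorem homogeneousComponent_mul_of_isHomogeneous {f : MvPolynomial σ R} {p : ℕ}
    (hf : f.IsHomogeneous p) (r : MvPolynomial σ R) (d : ℕ) :
    homogeneousComponent (d + p) (r * f) = homogeneousComponent d r * f := by
  have := DirectSum.coe_decompose_mul_of_right_mem_of_le (homogeneousSubmodule σ R)
    (a := r) (b := f) (i := p) (n := d + p) hf (Nat.le_add_left _ _)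
  rw [Nat.add_sub_cancel] at this
  have e : ∀ (φ : MvPolynomial σ R) i,
      (DirectSum.decompose (homogeneousSubmodule σ R) φ i : MvPolynomial σ R) =
        homogeneousComponent i φ := decomposition.decompose'_apply
  rwa [e, e] at this

theorem homogeneousComponent_mul_of_isHomogeneous_of_lt {f : MvPolynomial σ R} {p : ℕ}
    (hf : f.IsHomogeneous p) (r : MvPolynomial σ R) {d : ℕ} (hd : d < p) :
    homogeneousComponent d (r * f) = 0 := by
  have := DirectSum.coe_decompose_mul_of_right_mem_of_not_le (homogeneousSubmodule σ R)
    (a := r) (b := f) (i := p) (n := d) hf (by omega)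
  have e : ∀ (φ : MvPolynomial σ R) i,
      (DirectSum.decompose (homogeneousSubmodule σ R) φ i : MvPolynomial σ R) =
        homogeneousComponent i φ := decomposition.decompose'_apply
  rwa [e] at this

end

instance finite_homogeneousSubmodule {σ R : Type*} [CommRing R] [Finite σ] (d : ℕ) :
    Module.Finite R (homogeneousSubmodule σ R d) :=
  Module.Finite.iff_fg.2 (homogeneousSubmodule_fg σ R d)

end MvPolynomial

namespace Liaison

open MvPolynomial RingTheory.Sequence

variable {k : Type*} [Field k] {n : ℕ}

/-- The homogeneous components of the elements of `I` lie in `I`. -/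
def IsGraded (I : Ideal (MvPolynomial (Fin n) k)) : Prop :=
  ∀ f ∈ I, ∀ d, homogeneousComponent d f ∈ I

/-- The component of degree `d` of an element of an ideal generated by forms lies in the ideal
generated by those forms whose degree is at most `d`. -/
theorem homogeneousComponent_mem_span {s : Set (MvPolynomial (Fin n) k)}
    (hs : ∀ f ∈ s, ∃ d, f.IsHomogeneous d) {f : MvPolynomial (Fin n) k} (hf : f ∈ Ideal.span s)
    (d : ℕ) : homogeneousComponent d f ∈
      Ideal.span {g | g ∈ s ∧ ∃ e ≤ d, g.IsHomogeneous e} := by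
  suffices h : ∀ r, homogeneousComponent d (r * f) ∈
      Ideal.span {g | g ∈ s ∧ ∃ e ≤ d, g.IsHomogeneous e} by
    simpa using h 1
  induction hf using Submodule.span_induction with
  | mem f hf =>
    intro r
    obtain ⟨e, he⟩ := hs f hf
    rcases le_or_gt e d with h | h
    · obtain ⟨d', rfl⟩ := Nat.exists_eq_add_of_le' h
      rw [homogeneousComponent_mul_of_isHomogeneous he]
      exact Ideal.mul_mem_left _ _ (Ideal.subset_span ⟨hf, e, h, he⟩)
    · rw [homogeneousComponent_mul_of_isHomogeneous_of_lt he r h]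
      exact zero_mem _
  | zero => simp
  | add f g _ _ hf hg => intro r; rw [mul_add, map_add]; exact add_mem (hf r) (hg r)
  | smul c f _ hf => intro r; rw [smul_eq_mul, ← mul_assoc]; exact hf _

theorem isGraded_span {s : Set (MvPolynomial (Fin n) k)} (hs : ∀ f ∈ s, ∃ d, f.IsHomogeneous d) :
    IsGraded (Ideal.span s) := fun _ hf d =>
  Ideal.span_mono (fun _ hg => hg.1) (homogeneousComponent_mem_span hs hf d)

theorem IsRegularSeqOfForms.exists_isHomogeneous {fs : List (MvPolynomial (Fin n) k)} {a : List ℕ}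
    (h : List.Forall₂ (fun f d => f.IsHomogeneous d) fs a) :
    ∀ f ∈ fs, ∃ d ∈ a, f.IsHomogeneous d := by
  induction h with
  | nil => simp
  | cons h _ ih =>
    intro f hf
    rcases List.mem_cons.1 hf with rfl | hf
    · exact ⟨_, List.mem_cons_self, h⟩
    · obtain ⟨d, hd, hf⟩ := ih f hf
      exact ⟨d, List.mem_cons_of_mem _ hd, hf⟩

theorem IsRegularSeqOfForms.isGraded {fs : List (MvPolynomial (Fin n) k)} {a : List ℕ}
    (h : IsRegularSeqOfForms fs a) : IsGraded (Ideal.ofList fs) :=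
  isGraded_span fun f hf =>
    let ⟨d, _, hd⟩ := IsRegularSeqOfForms.exists_isHomogeneous h.2 f hf
    ⟨d, hd⟩

/-- The forms of degree `d` in `I`. -/
noncomputable def degreePart (I : Ideal (MvPolynomial (Fin n) k)) (d : ℕ) :
    Submodule k (homogeneousSubmodule (Fin n) k d) :=
  (I.restrictScalars k).comap (homogeneousSubmodule (Fin n) k d).subtype

theorem mem_degreePart {I : Ideal (MvPolynomial (Fin n) k)} {d : ℕ}
    {f : homogeneousSubmodule (Fin n) k d} :
    f ∈ degreePart I d ↔ (f : MvPolynomial (Fin n) k) ∈ I := Iff.rfl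

theorem hilbertFunction_add_finrank_degreePart (I : Ideal (MvPolynomial (Fin n) k)) (d : ℕ) :
    hilbertFunction I d + Module.finrank k (degreePart I d) =
      Module.finrank k (homogeneousSubmodule (Fin n) k d) := by
  have h : degreePart I d = LinearMap.ker
      ((Ideal.Quotient.mkₐ k I).toLinearMap.comp (homogeneousSubmodule (Fin n) k d).subtype) := by
    ext f
    exact (Ideal.Quotient.eq_zero_iff_mem (I := I)).symm
  rw [h, ← LinearMap.finrank_range_add_finrank_ker
    ((Ideal.Quotient.mkₐ k I).toLinearMap.comp (homogeneousSubmodule (Fin n) k d).subtype),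
    LinearMap.range_comp, Submodule.range_subtype]
  rfl

theorem hilbertFunction_eq_zero_iff {I : Ideal (MvPolynomial (Fin n) k)} {d : ℕ} :
    hilbertFunction I d = 0 ↔ ∀ f : MvPolynomial (Fin n) k, f.IsHomogeneous d → f ∈ I := by
  have h := hilbertFunction_add_finrank_degreePart I d
  constructor
  · intro h0 f hf
    have : degreePart I d = ⊤ := Submodule.eq_top_of_finrank_eq (by omega)
    have h1 : (⟨f, hf⟩ : homogeneousSubmodule (Fin n) k d) ∈ degreePart I d := this ▸ trivial
    exact h1
  · intro h0
    have : degreePart I d = ⊤ := top_unique fun f _ => h0 f f.2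
    rw [this, finrank_top] at h
    omega

theorem hilbertFunction_sup_span_of_lt {A : Ideal (MvPolynomial (Fin n) k)}
    {f : MvPolynomial (Fin n) k} {p d : ℕ} (hA : IsGraded A) (hf : f.IsHomogeneous p)
    (hd : d < p) : hilbertFunction (A ⊔ Ideal.span {f}) d = hilbertFunction A d := by
  have h1 := hilbertFunction_add_finrank_degreePart A d
  have h2 := hilbertFunction_add_finrank_degreePart (A ⊔ Ideal.span {f}) d
  have : degreePart (A ⊔ Ideal.span {f}) d = degreePart A d := by
    ext ⟨g, hg⟩
    simp only [mem_degreePart]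
    refine ⟨fun h => ?_, fun h => Ideal.mem_sup_left h⟩
    obtain ⟨a, ha, b, hb, rfl⟩ := Submodule.mem_sup.1 h
    obtain ⟨r, rfl⟩ := Ideal.mem_span_singleton'.1 hb
    rw [← homogeneousComponent_eq_self hg, map_add,
      homogeneousComponent_mul_of_isHomogeneous_of_lt hf r hd, add_zero]
    exact hA a ha d
  rw [this] at h2
  omega

theorem hilbertFunction_sup_span_add {A : Ideal (MvPolynomial (Fin n) k)}
    {f : MvPolynomial (Fin n) k} {p : ℕ} (hA : IsGraded A) (hf : f.IsHomogeneous p)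
    (hreg : ∀ g, f * g ∈ A → g ∈ A) (d : ℕ) :
    hilbertFunction (A ⊔ Ideal.span {f}) (d + p) + hilbertFunction A d =
      hilbertFunction A (d + p) := by
  let Q := MvPolynomial (Fin n) k ⧸ A
  let V : ℕ → Submodule k Q := fun e =>
    (homogeneousSubmodule (Fin n) k e).map (Ideal.Quotient.mkₐ k A).toLinearMap
  have hfin : ∀ e, FiniteDimensional k (V e) := fun e => Module.Finite.map _ _
  let ψ : V (d + p) →ₗ[k] MvPolynomial (Fin n) k ⧸ (A ⊔ Ideal.span {f}) :=
    (Ideal.Quotient.factorₐ k (le_sup_left : A ≤ A ⊔ Ideal.span {f})).toLinearMap.domRestrict _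
  let μ : V d →ₗ[k] Q :=
    (LinearMap.mulLeft k (Ideal.Quotient.mk A f)).domRestrict (V d)
  have hμ : Function.Injective μ := by
    rw [injective_iff_map_eq_zero]
    rintro ⟨q, g, hg, rfl⟩ h
    have h' : Ideal.Quotient.mk A (f * g) = 0 := by rw [map_mul]; exact h
    exact Subtype.ext (Ideal.Quotient.eq_zero_iff_mem.2
      (hreg g (Ideal.Quotient.eq_zero_iff_mem.1 h')))
  have hrange : LinearMap.range ψ = (homogeneousSubmodule (Fin n) k (d + p)).map
      (Ideal.Quotient.mkₐ k (A ⊔ Ideal.span {f})).toLinearMap := by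
    rw [LinearMap.range_domRestrict, ← Submodule.map_comp]
    rfl
  have hker : (LinearMap.ker ψ).map (V (d + p)).subtype = LinearMap.range μ := by
    ext q
    constructor
    · rintro ⟨⟨_, g, hg, rfl⟩, h, rfl⟩
      have h' : g ∈ A ⊔ Ideal.span {f} := Ideal.Quotient.eq_zero_iff_mem.1 h
      obtain ⟨a, ha, b, hb, hab⟩ := Submodule.mem_sup.1 h'
      obtain ⟨r, rfl⟩ := Ideal.mem_span_singleton'.1 hb
      have h2 : g = homogeneousComponent (d + p) a + homogeneousComponent d r * f := by
        rw [← homogeneousComponent_mul_of_isHomogeneous hf, ← map_add, hab,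
          homogeneousComponent_eq_self hg]
      refine ⟨⟨_, homogeneousComponent d r, homogeneousComponent_mem _ _, rfl⟩, ?_⟩
      change Ideal.Quotient.mk A f * Ideal.Quotient.mk A (homogeneousComponent d r) =
        Ideal.Quotient.mk A g
      rw [← map_mul, Ideal.Quotient.mk_eq_mk_iff_sub_mem, h2]
      convert neg_mem (hA a ha (d + p)) using 1
      ring
    · rintro ⟨⟨_, g, hg, rfl⟩, rfl⟩
      refine ⟨⟨Ideal.Quotient.mk A (g * f), g * f, IsHomogeneous.mul hg hf, rfl⟩, ?_, ?_⟩
      · exact Ideal.Quotient.eq_zero_iff_mem.2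
          (Ideal.mem_sup_right (Ideal.mul_mem_left _ _ (Ideal.mem_span_singleton_self f)))
      · change Ideal.Quotient.mk A (g * f) = Ideal.Quotient.mk A f * Ideal.Quotient.mk A g
        rw [mul_comm g f, map_mul]
  have h1 := LinearMap.finrank_range_add_finrank_ker ψ
  rw [hrange, ← LinearEquiv.finrank_eq ((LinearMap.ker ψ).equivMapOfInjective _
    (V (d + p)).injective_subtype).symm, hker, LinearMap.finrank_range_of_inj hμ] at h1
  exact h1

theorem IsRegularSeqOfForms.of_append {fs : List (MvPolynomial (Fin n) k)} {a b : List ℕ}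
    (h : IsRegularSeqOfForms fs (a ++ b)) :
    ∃ gs hs, fs = gs ++ hs ∧ IsRegularSeqOfForms gs a ∧
      List.Forall₂ (fun f d => f.IsHomogeneous d) hs b := by
  obtain ⟨hreg, hdeg⟩ := h
  refine ⟨fs.take a.length, fs.drop a.length, (List.take_append_drop _ _).symm, ⟨?_, ?_⟩, ?_⟩
  · rw [← List.take_append_drop a.length fs] at hreg
    exact hreg.of_append_left
  · simpa using List.forall₂_take a.length hdeg
  · simpa using List.forall₂_drop a.length hdeg

theorem IsRegularSeqOfForms.of_append_singleton {fs : List (MvPolynomial (Fin n) k)} {a : List ℕ}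
    {p : ℕ} (h : IsRegularSeqOfForms fs (a ++ [p])) :
    ∃ gs g, fs = gs ++ [g] ∧ IsRegularSeqOfForms gs a ∧ g.IsHomogeneous p := by
  obtain ⟨gs, hs, rfl, h1, h2⟩ := h.of_append
  cases h2 with
  | cons h2 h3 =>
    cases h3
    exact ⟨gs, _, rfl, h1, h2⟩

/-- The Hilbert function of a complete intersection depends only on the degrees. -/
theorem hilbertFunction_eq_of_isRegularSeqOfForms {a : List ℕ} :
    ∀ {fs gs : List (MvPolynomial (Fin n) k)}, IsRegularSeqOfForms fs a →
    IsRegularSeqOfForms gs a → ∀ d,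
    hilbertFunction (Ideal.ofList fs) d = hilbertFunction (Ideal.ofList gs) d := by
  induction a using List.reverseRecOn with
  | nil =>
    intro fs gs hf hg d
    rw [List.forall₂_nil_right_iff.1 hf.2, List.forall₂_nil_right_iff.1 hg.2]
  | append_singleton a p ih =>
    intro fs gs hf hg d
    obtain ⟨fs, f, rfl, hfs, hfp⟩ := hf.of_append_singleton
    obtain ⟨gs, g, rfl, hgs, hgp⟩ := hg.of_append_singleton
    rw [Ideal.ofList_append, Ideal.ofList_append, Ideal.ofList_singleton, Ideal.ofList_singleton]
    rcases lt_or_ge d p with h | h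
    · rw [hilbertFunction_sup_span_of_lt hfs.isGraded hfp h,
        hilbertFunction_sup_span_of_lt hgs.isGraded hgp h]
      exact ih hfs hgs d
    · obtain ⟨d, rfl⟩ := Nat.exists_eq_add_of_le' h
      have h1 := hilbertFunction_sup_span_add hfs.isGraded hfp
        (isWeaklyRegular_append_singleton_iff.1 hf.1.1).2 d
      have h2 := hilbertFunction_sup_span_add hgs.isGraded hgp
        (isWeaklyRegular_append_singleton_iff.1 hg.1.1).2 d
      have h3 := ih hfs hgs d
      have h4 := ih hfs hgs (d + p)
      omega

end Liaison

namespace Liaison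

open MvPolynomial RingTheory.Sequence

variable {k : Type*} [Field k] {n : ℕ}

theorem support_monomial_one (m : Fin n →₀ ℕ) : (monomial m (1 : k)).support = {m} := by
  classical
  rw [support_monomial, if_neg one_ne_zero]

theorem isMonomialIdeal_iff {D : Ideal (MvPolynomial (Fin n) k)} :
    IsMonomialIdeal D ↔ ∀ f, f ∈ D ↔ ∀ m ∈ f.support, monomial m (1 : k) ∈ D := by
  constructor
  · rintro ⟨A, rfl⟩ f
    simp only [mem_ideal_span_monomial_image]
    refine forall₂_congr fun m _ => ?_
    rw [support_monomial_one]
    simp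
  · intro h
    refine ⟨{m | monomial m (1 : k) ∈ D}, le_antisymm (fun f hf => ?_) (Ideal.span_le.2 ?_)⟩
    · rw [mem_ideal_span_monomial_image]
      exact fun m hm => ⟨m, (h f).1 hf m hm, le_rfl⟩
    · rintro _ ⟨m, hm, rfl⟩
      exact hm

theorem IsMonomialIdeal.isGraded {D : Ideal (MvPolynomial (Fin n) k)} (h : IsMonomialIdeal D) :
    IsGraded D := by
  obtain ⟨A, rfl⟩ := h
  refine isGraded_span ?_
  rintro _ ⟨m, _, rfl⟩
  exact ⟨_, isHomogeneous_monomial 1 rfl⟩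

theorem mem_support_monomial_mul {m p : Fin n →₀ ℕ} {f : MvPolynomial (Fin n) k} :
    m + p ∈ (monomial m (1 : k) * f).support ↔ p ∈ f.support := by
  rw [mem_support_iff, mem_support_iff, coeff_monomial_mul, one_mul]

theorem IsMonomialIdeal.colon {J M : Ideal (MvPolynomial (Fin n) k)} (hJ : IsMonomialIdeal J)
    (hM : IsMonomialIdeal M) : IsMonomialIdeal (Submodule.colon J (M : Set _)) := by
  obtain ⟨B, rfl⟩ := hM
  have key : ∀ f, f ∈ Submodule.colon J
      ((Ideal.span ((fun m => monomial m (1 : k)) '' B) : Ideal _) : Set (MvPolynomial (Fin n) k)) ↔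
      ∀ p ∈ f.support, ∀ m ∈ B, monomial (m + p) (1 : k) ∈ J := by
    intro f
    rw [show (((Ideal.span ((fun m => monomial m (1 : k)) '' B) : Ideal _) :
      Set (MvPolynomial (Fin n) k))) = (Submodule.span (MvPolynomial (Fin n) k)
        ((fun m => monomial m (1 : k)) '' B) : Set (MvPolynomial (Fin n) k)) from rfl,
      Submodule.colon_span, Submodule.mem_colon]
    constructor
    · intro h p hp m hm
      have h1 := h _ ⟨m, hm, rfl⟩
      rw [smul_eq_mul, mul_comm, isMonomialIdeal_iff.1 hJ] at h1
      exact h1 _ (mem_support_monomial_mul.2 hp)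
    · rintro h _ ⟨m, hm, rfl⟩
      rw [smul_eq_mul, mul_comm, isMonomialIdeal_iff.1 hJ]
      intro q hq
      obtain ⟨p, hp, rfl⟩ : ∃ p ∈ f.support, m + p = q := by
        rw [mem_support_iff, coeff_monomial_mul'] at hq
        have hle : m ≤ q := by
          by_contra hle
          exact hq (if_neg hle)
        rw [if_pos hle, one_mul] at hq
        exact ⟨q - m, mem_support_iff.2 hq, add_tsub_cancel_of_le hle⟩
      exact h p hp m hm
  rw [isMonomialIdeal_iff]
  intro f
  rw [key]
  refine forall₂_congr fun p _ => ?_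
  rw [key, support_monomial_one]
  simp

theorem ofList_map_X_pow (l : List (Fin n × ℕ)) :
    (Ideal.ofList (l.map fun p => (X p.1 ^ p.2 : MvPolynomial (Fin n) k))) =
      Ideal.span ((fun m => monomial m (1 : k)) '' {m | ∃ p ∈ l, m = Finsupp.single p.1 p.2}) := by
  refine congrArg Ideal.span ?_
  ext f
  constructor
  · intro hf
    obtain ⟨p, hp, rfl⟩ := List.mem_map.1 hf
    exact ⟨_, ⟨p, hp, rfl⟩, (X_pow_eq_monomial).symm⟩
  · rintro ⟨_, ⟨p, hp, rfl⟩, rfl⟩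
    exact List.mem_map.2 ⟨p, hp, X_pow_eq_monomial⟩

theorem isMonomialIdeal_ofList_map_X_pow (l : List (Fin n × ℕ)) :
    IsMonomialIdeal (Ideal.ofList (l.map fun p => (X p.1 ^ p.2 : MvPolynomial (Fin n) k))) :=
  ⟨_, ofList_map_X_pow l⟩

theorem mem_ofList_map_X_pow {l : List (Fin n × ℕ)} {f : MvPolynomial (Fin n) k} :
    f ∈ Ideal.ofList (l.map fun p => (X p.1 ^ p.2 : MvPolynomial (Fin n) k)) ↔
      ∀ m ∈ f.support, ∃ p ∈ l, p.2 ≤ m p.1 := by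
  rw [ofList_map_X_pow, mem_ideal_span_monomial_image]
  refine forall₂_congr fun m _ => ?_
  constructor
  · rintro ⟨_, ⟨p, hp, rfl⟩, h⟩
    exact ⟨p, hp, by simpa using h p.1⟩
  · rintro ⟨p, hp, h⟩
    exact ⟨_, ⟨p, hp, rfl⟩, by simpa using h⟩

theorem isWeaklyRegular_map_X_pow {l : List (Fin n × ℕ)} (h : (l.map Prod.fst).Nodup) :
    IsWeaklyRegular (MvPolynomial (Fin n) k)
      (l.map fun p => (X p.1 ^ p.2 : MvPolynomial (Fin n) k)) := by
  induction l using List.reverseRecOn with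
  | nil => exact IsWeaklyRegular.nil _ _
  | append_singleton l q ih =>
    rw [List.map_append, List.nodup_append] at h
    rw [List.map_append, List.map_singleton, isWeaklyRegular_append_singleton_iff]
    refine ⟨ih h.1, fun g hg => ?_⟩
    rw [mem_ofList_map_X_pow] at hg ⊢
    intro m hm
    rw [X_pow_eq_monomial] at hg
    obtain ⟨p, hp, hle⟩ := hg _ (mem_support_monomial_mul.2 hm)
    have hne : q.1 ≠ p.1 := fun e =>
      h.2.2 p.1 (List.mem_map_of_mem hp) q.1 (by simp) e.symm
    refine ⟨p, hp, ?_⟩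
    simpa [Finsupp.single_apply, hne] using hle

theorem isRegularSeqOfForms_map_X_pow {l : List (Fin n × ℕ)} (h : (l.map Prod.fst).Nodup)
    (hpos : ∀ p ∈ l, 0 < p.2) :
    IsRegularSeqOfForms (l.map fun p => (X p.1 ^ p.2 : MvPolynomial (Fin n) k))
      (l.map Prod.snd) := by
  refine ⟨isRegular_self_iff.2 ⟨isWeaklyRegular_map_X_pow h, fun htop => ?_⟩, ?_⟩
  · have h1 : (1 : MvPolynomial (Fin n) k) ∈
        Ideal.ofList (l.map fun p => (X p.1 ^ p.2 : MvPolynomial (Fin n) k)) := htop ▸ trivial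
    rw [mem_ofList_map_X_pow] at h1
    obtain ⟨p, hp, hle⟩ := h1 0 (by simp)
    have := hpos p hp
    simp at hle
    omega
  · rw [List.forall₂_map_left_iff, List.forall₂_map_right_iff, List.forall₂_same]
    exact fun p _ => isHomogeneous_X_pow _ _

/-- The sequence `x_{τ 0}^{c 0}, …, x_{τ (n-1)}^{c (n-1)}` is regular. -/
theorem isRegularSeqOfForms_ofFn_X_pow {c : Fin n → ℕ} (hc : ∀ i, 0 < c i)
    (τ : Equiv.Perm (Fin n)) :
    IsRegularSeqOfForms (List.ofFn fun i => (X (τ i) ^ c i : MvPolynomial (Fin n) k))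
      (List.ofFn c) := by
  have := isRegularSeqOfForms_map_X_pow (k := k) (l := List.ofFn fun i => (τ i, c i))
    (by
      rw [List.map_ofFn]
      exact List.nodup_ofFn.2 τ.injective)
    (by
      intro p hp
      obtain ⟨i, rfl⟩ := (List.mem_ofFn' _ _).1 hp
      exact hc i)
  rwa [List.map_ofFn, List.map_ofFn] at this

theorem isMonomialIdeal_ofList_ofFn_X_pow (c : Fin n → ℕ) (τ : Equiv.Perm (Fin n)) :
    IsMonomialIdeal
      (Ideal.ofList (List.ofFn fun i => (X (τ i) ^ c i : MvPolynomial (Fin n) k))) := by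
  have := isMonomialIdeal_ofList_map_X_pow (k := k) (List.ofFn fun i => (τ i, c i))
  rwa [List.map_ofFn] at this

theorem mem_ofList_ofFn_X_pow {c : Fin n → ℕ} {f : MvPolynomial (Fin n) k} :
    f ∈ Ideal.ofList (List.ofFn fun i => (X i ^ c i : MvPolynomial (Fin n) k)) ↔
      ∀ m ∈ f.support, ∃ i, c i ≤ m i := by
  have := mem_ofList_map_X_pow (l := List.ofFn fun i => (i, c i)) (f := f)
  rw [List.map_ofFn] at this
  refine this.trans (forall₂_congr fun m _ => ?_)
  constructor
  · rintro ⟨p, hp, h⟩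
    obtain ⟨i, rfl⟩ := (List.mem_ofFn' _ _).1 hp
    exact ⟨i, h⟩
  · rintro ⟨i, h⟩
    exact ⟨(i, c i), (List.mem_ofFn' _ _).2 ⟨i, rfl⟩, h⟩

theorem hilbertFunction_ofList_ofFn_X_pow_of_lt {c : Fin n → ℕ}
    {d : ℕ} (hd : ∑ i, (c i - 1) < d) :
    hilbertFunction (Ideal.ofList (List.ofFn fun i => (X i ^ c i : MvPolynomial (Fin n) k))) d
      = 0 := by
  rw [hilbertFunction_eq_zero_iff]
  intro f hf
  rw [mem_ofList_ofFn_X_pow]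
  intro m hm
  by_contra! h
  have h1 : m.degree = d := by
    by_contra hne
    exact mem_support_iff.1 hm (hf.coeff_eq_zero hne)
  rw [Finsupp.degree_eq_sum] at h1
  have : ∑ i, m i ≤ ∑ i, (c i - 1) := Finset.sum_le_sum fun i _ => by have := h i; omega
  omega

theorem hilbertFunction_ofList_ofFn_X_pow_ne_zero {c : Fin n → ℕ} (hc : ∀ i, 0 < c i) :
    hilbertFunction (Ideal.ofList (List.ofFn fun i => (X i ^ c i : MvPolynomial (Fin n) k)))
      (∑ i, (c i - 1)) ≠ 0 := by
  rw [Ne, hilbertFunction_eq_zero_iff]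
  intro h
  have h1 := h (monomial (Finsupp.equivFunOnFinite.symm fun i => c i - 1) 1)
    (isHomogeneous_monomial 1 (by rw [Finsupp.degree_eq_sum]; rfl))
  rw [mem_ofList_ofFn_X_pow] at h1
  obtain ⟨i, hi⟩ := h1 (Finsupp.equivFunOnFinite.symm fun i => c i - 1) (by simp)
  have := hc i
  simp at hi
  omega

theorem IsRegularSeqOfForms.pos {fs : List (MvPolynomial (Fin n) k)} {a : List ℕ}
    (h : IsRegularSeqOfForms fs a) : ∀ d ∈ a, 0 < d := by
  obtain ⟨hreg, hdeg⟩ := h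
  intro d hd
  obtain ⟨i, hi, rfl⟩ := List.getElem_of_mem hd
  have hi' : i < fs.length := by rw [hdeg.length_eq]; exact hi
  have hf : fs[i].IsHomogeneous a[i] := hdeg.get hi' hi
  by_contra h0
  rw [Nat.eq_zero_of_not_pos h0, ← totalDegree_zero_iff_isHomogeneous,
    totalDegree_eq_zero_iff_eq_C] at hf
  have hmem : fs[i] ∈ fs := List.getElem_mem hi'
  have hne : coeff 0 fs[i] ≠ 0 := fun hz => hreg.zero_notMem (by
    rw [hz, map_zero] at hf; rwa [← hf])
  refine (isRegular_self_iff.1 hreg).2 (Ideal.eq_top_of_isUnit_mem _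
    (Ideal.subset_span hmem) ?_)
  rw [hf]
  exact (isUnit_iff_ne_zero.2 hne).map C

end Liaison

theorem LinearMap.finrank_add_finrank_ker_flip {K U V : Type*} [Field K] [AddCommGroup U]
    [Module K U] [AddCommGroup V] [Module K V] [FiniteDimensional K U] [FiniteDimensional K V]
    (B : U →ₗ[K] V →ₗ[K] K) :
    Module.finrank K U + Module.finrank K (LinearMap.ker B.flip) =
      Module.finrank K V + Module.finrank K (LinearMap.ker B) := by
  have h1 := LinearMap.finrank_range_add_finrank_ker B
  have h2 := LinearMap.finrank_range_add_finrank_ker B.flip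
  have h3 : LinearMap.range B.flip = LinearMap.range (Module.Dual.transpose (R := K) B) := by
    have : B.flip = (Module.Dual.transpose (R := K) B).comp
        (Module.evalEquiv K V).toLinearMap := by
      ext v u
      rfl
    rw [this, LinearEquiv.range_comp]
  have h4 : Module.finrank K (LinearMap.range (Module.Dual.transpose (R := K) B)) =
      Module.finrank K (LinearMap.range B) :=
    LinearMap.finrank_range_dualMap_eq_finrank_range B
  rw [h3, h4] at h2
  omega

namespace Liaison

open MvPolynomial RingTheory.Sequence

variable {k : Type*} [Field k] {n : ℕ}

variable (k n) in
/-- The irrelevant maximal ideal. -/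
noncomputable def irrelevant : Ideal (MvPolynomial (Fin n) k) :=
  Ideal.ofList (List.ofFn fun i => X i ^ 1)

theorem mem_irrelevant {f : MvPolynomial (Fin n) k} : f ∈ irrelevant k n ↔ coeff 0 f = 0 := by
  rw [irrelevant, mem_ofList_ofFn_X_pow (c := fun _ => 1)]
  constructor
  · intro h
    by_contra h0
    obtain ⟨i, hi⟩ := h 0 (mem_support_iff.2 h0)
    simp at hi
  · intro h m hm
    by_contra! hlt
    have : m = 0 := by
      ext i
      have := hlt i
      simp only [Finsupp.coe_zero, Pi.zero_apply]
      omega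
    exact mem_support_iff.1 hm (this ▸ h)

theorem X_mem_irrelevant (i : Fin n) : (X i : MvPolynomial (Fin n) k) ∈ irrelevant k n := by
  rw [mem_irrelevant, coeff_zero_X]

theorem irrelevant_le_iff {P : Ideal (MvPolynomial (Fin n) k)} :
    irrelevant k n ≤ P ↔ ∀ i, (X i : MvPolynomial (Fin n) k) ∈ P := by
  refine ⟨fun h i => h (X_mem_irrelevant i), fun h => Ideal.span_le.2 fun f hf => ?_⟩
  obtain ⟨i, rfl⟩ := (List.mem_ofFn' _ _).1 hf
  simpa using h i

theorem IsRegularSeqOfForms.mem_irrelevant {fs : List (MvPolynomial (Fin n) k)} {a : List ℕ}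
    (h : IsRegularSeqOfForms fs a) : ∀ f ∈ fs, f ∈ irrelevant k n := by
  intro f hf
  obtain ⟨d, hd, hfd⟩ := IsRegularSeqOfForms.exists_isHomogeneous h.2 f hf
  rw [Liaison.mem_irrelevant]
  exact hfd.coeff_eq_zero (by simpa using (h.pos d hd).ne)

/-- The socle of an Artinian complete intersection is at most one-dimensional. -/
theorem exists_sub_C_mul_mem {gs : List (MvPolynomial (Fin n) k)} {a : List ℕ}
    (hgs : IsRegularSeqOfForms gs a) (hlen : a.length = n) {u w : MvPolynomial (Fin n) k}
    (hu : ∀ i, X i * u ∈ Ideal.ofList gs) (hw : ∀ i, X i * w ∈ Ideal.ofList gs)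
    (hw' : w ∉ Ideal.ofList gs) : ∃ c : k, u - C c * w ∈ Ideal.ofList gs := by
  have hX := isRegularSeqOfForms_ofFn_X_pow (k := k) (c := fun _ : Fin n => 1)
    (fun _ => one_pos) (Equiv.refl _)
  obtain ⟨e⟩ := nonempty_torsionBySet_quotient_equiv (K := irrelevant k n)
    (M := MvPolynomial (Fin n) k) n (hgs.2.length_eq.trans hlen) (by simp) hgs.1.1 hX.1.1
    hgs.mem_irrelevant hX.mem_irrelevant
  have hmk : ∀ {l : List (MvPolynomial (Fin n) k)} {f : MvPolynomial (Fin n) k},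
      Submodule.Quotient.mk (p := (Ideal.ofList l • ⊤ : Ideal (MvPolynomial (Fin n) k))) f = 0
        ↔ f ∈ Ideal.ofList l := by
    intro l f
    rw [Submodule.Quotient.mk_eq_zero, smul_eq_mul, Ideal.mul_top]
  have htor : ∀ f : MvPolynomial (Fin n) k, (∀ i, X i * f ∈ Ideal.ofList gs) →
      Submodule.Quotient.mk (p := (Ideal.ofList gs • ⊤ : Ideal (MvPolynomial (Fin n) k))) f ∈
        Submodule.torsionBySet (MvPolynomial (Fin n) k) _
          (irrelevant k n : Set (MvPolynomial (Fin n) k)) := by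
    intro f hf
    rw [Submodule.mem_torsionBySet_iff]
    rintro ⟨x, hx⟩
    refine hmk.2 ?_
    have hle : irrelevant k n ≤ Submodule.colon (Ideal.ofList gs) {f} :=
      irrelevant_le_iff.2 fun i => by
        rw [Submodule.mem_colon_singleton]
        exact hf i
    exact Submodule.mem_colon_singleton.1 (hle hx)
  obtain ⟨p, hp⟩ := Submodule.mkQ_surjective _ (e ⟨_, htor u hu⟩).1
  obtain ⟨q, hq⟩ := Submodule.mkQ_surjective _ (e ⟨_, htor w hw⟩).1
  have hzero : ∀ f : MvPolynomial (Fin n) k, coeff 0 f = 0 →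
      Submodule.mkQ (Ideal.ofList (List.ofFn fun i => (X ((Equiv.refl (Fin n)) i) ^ 1 :
        MvPolynomial (Fin n) k)) • ⊤ : Ideal (MvPolynomial (Fin n) k)) f = 0 :=
    fun f hf => hmk.2 (mem_irrelevant.2 hf)
  have hq0 : coeff 0 q ≠ 0 := by
    intro h0
    have h1 : e ⟨_, htor w hw⟩ = 0 := Subtype.ext (by rw [← hq, hzero q h0]; rfl)
    rw [LinearEquiv.map_eq_zero_iff] at h1
    exact hw' (hmk.1 (congrArg Subtype.val h1))
  refine ⟨coeff 0 p / coeff 0 q, ?_⟩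
  set c := coeff 0 p / coeff 0 q with hc
  have h1 : e (⟨_, htor u hu⟩ - (C c : MvPolynomial (Fin n) k) • ⟨_, htor w hw⟩) = 0 := by
    apply Subtype.ext
    rw [map_sub, map_smul, Submodule.coe_sub, Submodule.coe_smul, ← hp, ← hq, ← map_smul, ← map_sub,
      hzero _ (by rw [smul_eq_mul, coeff_sub, coeff_C_mul, hc, div_mul_cancel₀ _ hq0, sub_self])]
    rfl
  rw [LinearEquiv.map_eq_zero_iff] at h1
  exact hmk.1 (congrArg Subtype.val h1)

section Duality

variable {gs : List (MvPolynomial (Fin n) k)} {a : Fin n → ℕ}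

theorem IsRegularSeqOfForms.pos_ofFn (hgs : IsRegularSeqOfForms gs (List.ofFn a)) (i : Fin n) :
    0 < a i :=
  hgs.pos _ ((List.mem_ofFn' _ _).2 ⟨i, rfl⟩)

theorem IsRegularSeqOfForms.hilbertFunction_eq (hgs : IsRegularSeqOfForms gs (List.ofFn a))
    (d : ℕ) : hilbertFunction (Ideal.ofList gs) d =
      hilbertFunction (Ideal.ofList (List.ofFn fun i => (X i ^ a i : MvPolynomial (Fin n) k))) d :=
  hilbertFunction_eq_of_isRegularSeqOfForms hgs
    (isRegularSeqOfForms_ofFn_X_pow hgs.pos_ofFn (Equiv.refl _)) d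

theorem IsRegularSeqOfForms.mem_of_lt (hgs : IsRegularSeqOfForms gs (List.ofFn a))
    {f : MvPolynomial (Fin n) k} {d : ℕ} (hd : ∑ i, (a i - 1) < d) (hf : f.IsHomogeneous d) :
    f ∈ Ideal.ofList gs := by
  have h := hilbertFunction_ofList_ofFn_X_pow_of_lt (k := k) hd
  rw [← hgs.hilbertFunction_eq, hilbertFunction_eq_zero_iff] at h
  exact h f hf

theorem IsRegularSeqOfForms.exists_notMem (hgs : IsRegularSeqOfForms gs (List.ofFn a)) :
    ∃ w : MvPolynomial (Fin n) k, w.IsHomogeneous (∑ i, (a i - 1)) ∧ w ∉ Ideal.ofList gs := by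
  have h := hilbertFunction_ofList_ofFn_X_pow_ne_zero (k := k) hgs.pos_ofFn
  rw [← hgs.hilbertFunction_eq, Ne, hilbertFunction_eq_zero_iff] at h
  push Not at h
  exact h

theorem IsRegularSeqOfForms.X_mul_mem (hgs : IsRegularSeqOfForms gs (List.ofFn a))
    {w : MvPolynomial (Fin n) k} (hw : w.IsHomogeneous (∑ i, (a i - 1))) (i : Fin n) :
    X i * w ∈ Ideal.ofList gs :=
  hgs.mem_of_lt (d := 1 + ∑ i, (a i - 1)) (by omega) ((isHomogeneous_X k i).mul hw)

/-- The socle of an Artinian complete intersection is concentrated in the top degree. -/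
theorem IsRegularSeqOfForms.mem_of_forall_X_mul_mem (hgs : IsRegularSeqOfForms gs (List.ofFn a))
    {u : MvPolynomial (Fin n) k} {d : ℕ} (hd : d ≠ ∑ i, (a i - 1)) (hu : u.IsHomogeneous d)
    (hX : ∀ i, X i * u ∈ Ideal.ofList gs) : u ∈ Ideal.ofList gs := by
  obtain ⟨w, hw, hw'⟩ := hgs.exists_notMem
  obtain ⟨c, hc⟩ := exists_sub_C_mul_mem hgs List.length_ofFn hX (hgs.X_mul_mem hw) hw'
  have h := hgs.isGraded _ hc d
  rwa [map_sub, homogeneousComponent_C_mul, homogeneousComponent_eq_self hu,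
    homogeneousComponent_of_mem hw, if_neg hd, mul_zero, sub_zero] at h

theorem IsRegularSeqOfForms.exists_mul_notMem (hgs : IsRegularSeqOfForms gs (List.ofFn a)) (t : ℕ) :
    ∀ {d : ℕ}, d + t = ∑ i, (a i - 1) → ∀ {u : MvPolynomial (Fin n) k}, u.IsHomogeneous d →
      u ∉ Ideal.ofList gs → ∃ v : MvPolynomial (Fin n) k, v.IsHomogeneous t ∧
        u * v ∉ Ideal.ofList gs := by
  induction t with
  | zero =>
    intro d _ u _ hu'
    exact ⟨1, isHomogeneous_one _ _, by simpa using hu'⟩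
  | succ t ih =>
    intro d hd u hu hu'
    have : ∃ i, X i * u ∉ Ideal.ofList gs := by
      by_contra! h
      exact hu' (hgs.mem_of_forall_X_mul_mem (by omega) hu h)
    obtain ⟨i, hi⟩ := this
    obtain ⟨v, hv, hv'⟩ := ih (d := 1 + d) (by omega) ((isHomogeneous_X k i).mul hu) hi
    refine ⟨X i * v, by simpa [add_comm] using (isHomogeneous_X k i).mul hv, ?_⟩
    rwa [← mul_assoc, mul_comm u]

/-- A linear functional detecting the forms of top degree outside of a complete intersection. -/
theorem IsRegularSeqOfForms.exists_functional (hgs : IsRegularSeqOfForms gs (List.ofFn a)) :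
    ∃ ψ : MvPolynomial (Fin n) k →ₗ[k] k, (∀ f ∈ Ideal.ofList gs, ψ f = 0) ∧
      ∀ f : MvPolynomial (Fin n) k, f.IsHomogeneous (∑ i, (a i - 1)) → ψ f = 0 →
        f ∈ Ideal.ofList gs := by
  obtain ⟨w, hw, hw'⟩ := hgs.exists_notMem
  obtain ⟨ψ, hψw, hψ⟩ := Submodule.exists_le_ker_of_notMem
    (p := (Ideal.ofList gs).restrictScalars k) (v := w) hw'
  refine ⟨ψ, fun f hf => hψ hf, fun f hf h0 => ?_⟩
  obtain ⟨c, hc⟩ := exists_sub_C_mul_mem hgs List.length_ofFn (hgs.X_mul_mem hf)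
    (hgs.X_mul_mem hw) hw'
  have h1 : ψ (f - C c * w) = 0 := hψ hc
  rw [map_sub, h0, C_mul', map_smul, zero_sub, neg_eq_zero, smul_eq_mul, mul_eq_zero] at h1
  have hc0 : c = 0 := h1.resolve_right hψw
  rwa [hc0, map_zero, zero_mul, sub_zero] at hc

theorem mul_mem_of_forall_isHomogeneous {I J : Ideal (MvPolynomial (Fin n) k)} (hI : IsGraded I)
    {u : MvPolynomial (Fin n) k}
    (h : ∀ e, ∀ v ∈ I, v.IsHomogeneous e → u * v ∈ J) : u ∈ Submodule.colon J (I : Set _) := by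
  rw [Submodule.mem_colon]
  intro v hv
  rw [smul_eq_mul, ← sum_homogeneousComponent v, Finset.mul_sum]
  exact sum_mem fun e _ => h e _ (hI v hv e) (homogeneousComponent_isHomogeneous e v)

/-- The Hilbert function of a linked ideal. -/
theorem IsRegularSeqOfForms.hilbertFunction_colon (hgs : IsRegularSeqOfForms gs (List.ofFn a))
    {I : Ideal (MvPolynomial (Fin n) k)} (hI : IsGraded I) (hle : Ideal.ofList gs ≤ I) {d t : ℕ}
    (hdt : d + t = ∑ i, (a i - 1)) :
    hilbertFunction (Submodule.colon (Ideal.ofList gs) (I : Set _)) d + hilbertFunction I t =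
      hilbertFunction (Ideal.ofList gs) t := by
  obtain ⟨ψ, hψ, hψ'⟩ := hgs.exists_functional
  let B : homogeneousSubmodule (Fin n) k d →ₗ[k] degreePart I t →ₗ[k] k :=
    (((LinearMap.mul k (MvPolynomial (Fin n) k)).compr₂ ψ).domRestrict₁₂
      (homogeneousSubmodule (Fin n) k d) (homogeneousSubmodule (Fin n) k t)).compl₂
        (degreePart I t).subtype
  have hB : ∀ u v, B u v = ψ (u.1 * v.1.1) := fun _ _ => rfl
  have hψB : ∀ (u : homogeneousSubmodule (Fin n) k d) (v : MvPolynomial (Fin n) k),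
      v.IsHomogeneous t → ψ (u.1 * v) = 0 → u.1 * v ∈ Ideal.ofList gs := by
    intro u v hv h
    exact hψ' _ (hdt ▸ IsHomogeneous.mul u.2 hv) h
  have hker : LinearMap.ker B = degreePart (Submodule.colon (Ideal.ofList gs) (I : Set _)) d := by
    ext u
    rw [LinearMap.mem_ker, mem_degreePart]
    constructor
    · intro h
      refine mul_mem_of_forall_isHomogeneous hI fun e v hv hve => ?_
      by_contra hnot
      have huv := IsHomogeneous.mul u.2 hve
      have hle' : d + e ≤ ∑ i, (a i - 1) := by
        by_contra hlt
        exact hnot (hgs.mem_of_lt (by omega) huv)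
      obtain ⟨z, hz, hz'⟩ := hgs.exists_mul_notMem (∑ i, (a i - 1) - (d + e)) (by omega) huv hnot
      have hvz : (v * z).IsHomogeneous t := by
        convert hve.mul hz using 1
        omega
      refine hz' ?_
      rw [mul_assoc]
      exact hψB u _ hvz
        (LinearMap.congr_fun h ⟨⟨v * z, hvz⟩, Ideal.mul_mem_right _ _ hv⟩)
    · intro h
      ext v
      rw [hB]
      exact hψ _ (Submodule.mem_colon.1 h _ v.2)
  have hkerf : (LinearMap.ker B.flip).map (degreePart I t).subtype =
      degreePart (Ideal.ofList gs) t := by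
    ext v
    constructor
    · rintro ⟨v, hv, rfl⟩
      rw [mem_degreePart]
      by_contra hnot
      obtain ⟨u, hu, hu'⟩ := hgs.exists_mul_notMem d (by omega) v.1.2 hnot
      rw [mul_comm] at hu'
      exact hu' (hψB ⟨u, hu⟩ _ v.1.2 (LinearMap.congr_fun hv ⟨u, hu⟩))
    · intro hv
      refine ⟨⟨v, hle hv⟩, ?_, rfl⟩
      change B.flip _ = 0
      ext u
      exact hψ _ (Ideal.mul_mem_left _ _ hv)
  have h0 := LinearMap.finrank_add_finrank_ker_flip
    (U := homogeneousSubmodule (Fin n) k d) (V := degreePart I t) B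
  rw [hker, LinearEquiv.finrank_eq ((LinearMap.ker B.flip).equivMapOfInjective _
    (degreePart I t).injective_subtype), hkerf] at h0
  have h1 := hilbertFunction_add_finrank_degreePart
    (Submodule.colon (Ideal.ofList gs) (I : Set (MvPolynomial (Fin n) k))) d
  have h2 := hilbertFunction_add_finrank_degreePart I t
  have h3 := hilbertFunction_add_finrank_degreePart (Ideal.ofList gs) t
  omega

theorem IsRegularSeqOfForms.hilbertFunction_colon_of_lt
    (hgs : IsRegularSeqOfForms gs (List.ofFn a)) (I : Ideal (MvPolynomial (Fin n) k))
    {d : ℕ} (hd : ∑ i, (a i - 1) < d) :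
    hilbertFunction (Submodule.colon (Ideal.ofList gs) (I : Set _)) d = 0 := by
  rw [hilbertFunction_eq_zero_iff]
  intro f hf
  rw [Submodule.mem_colon]
  intro v _
  exact Ideal.mul_mem_right _ _ (hgs.mem_of_lt hd hf)

/-- The Hilbert function of a linked ideal depends only on the type of the link and on the Hilbert
function of the original ideal. -/
theorem hilbertFunction_colon_eq {gs' : List (MvPolynomial (Fin n) k)}
    {I I' : Ideal (MvPolynomial (Fin n) k)}
    (hgs : IsRegularSeqOfForms gs (List.ofFn a)) (hgs' : IsRegularSeqOfForms gs' (List.ofFn a))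
    (hI : IsGraded I) (hI' : IsGraded I') (hle : Ideal.ofList gs ≤ I) (hle' : Ideal.ofList gs' ≤ I')
    (hH : ∀ d, hilbertFunction I d = hilbertFunction I' d) (d : ℕ) :
    hilbertFunction (Submodule.colon (Ideal.ofList gs) (I : Set _)) d =
      hilbertFunction (Submodule.colon (Ideal.ofList gs') (I' : Set _)) d := by
  rcases lt_or_ge (∑ i, (a i - 1)) d with h | h
  · rw [hgs.hilbertFunction_colon_of_lt _ h, hgs'.hilbertFunction_colon_of_lt _ h]
  · obtain ⟨t, ht⟩ := Nat.exists_eq_add_of_le h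
    have h1 := hgs.hilbertFunction_colon hI hle ht.symm
    have h2 := hgs'.hilbertFunction_colon hI' hle' ht.symm
    have h3 := hilbertFunction_eq_of_isRegularSeqOfForms hgs hgs' t
    have h4 := hH t
    omega

end Duality

end Liaison

theorem Submodule.exists_forall_notMem_of_finite {k E : Type*} [DivisionRing k] [Infinite k]
    [AddCommGroup E] [Module k E] {s : Set (Submodule k E)} (hs : s.Finite) (htop : ⊤ ∉ s) :
    ∃ v : E, ∀ p ∈ s, v ∉ p := by
  have h := Subspace.biUnion_ne_univ_of_top_notMem (s := hs.toFinset) (by simpa using htop)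
  obtain ⟨v, hv⟩ := (Set.ne_univ_iff_exists_notMem _).1 h
  refine ⟨v, fun p hp hvp => hv ?_⟩
  exact Set.mem_biUnion (hs.mem_toFinset.2 hp) hvp

namespace Liaison

open MvPolynomial RingTheory.Sequence

variable {k : Type*} [Field k] {n : ℕ}

theorem IsRegularSeqOfForms.ne_zero {fs : List (MvPolynomial (Fin n) k)} {a : List ℕ}
    (h : IsRegularSeqOfForms fs a) {f : MvPolynomial (Fin n) k} (hf : f ∈ fs) : f ≠ 0 :=
  fun h0 => h.1.zero_notMem (h0 ▸ hf)

theorem IsRegularSeqOfForms.isHomogeneous_getElem {fs : List (MvPolynomial (Fin n) k)} {a : List ℕ}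
    (h : IsRegularSeqOfForms fs a) {i : ℕ} (hi : i < fs.length) (hi' : i < a.length) :
    fs[i].IsHomogeneous a[i] :=
  h.2.get hi hi'

theorem IsRegularSeqOfForms.append_singleton {gs : List (MvPolynomial (Fin n) k)} {a : List ℕ}
    (hgs : IsRegularSeqOfForms gs a) {I : Ideal (MvPolynomial (Fin n) k)} (hI : I ≠ ⊤)
    (hmem : ∀ g ∈ gs, g ∈ I) {h : MvPolynomial (Fin n) k} {d : ℕ} (hd : h.IsHomogeneous d)
    (hhI : h ∈ I) (hreg : IsSMulRegular
      (MvPolynomial (Fin n) k ⧸ (Ideal.ofList gs • ⊤ : Ideal (MvPolynomial (Fin n) k))) h) :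
    IsRegularSeqOfForms (gs ++ [h]) (a ++ [d]) := by
  refine ⟨isRegular_self_iff.2 ⟨?_, ?_⟩, List.rel_append hgs.2 (.cons hd .nil)⟩
  · exact isWeaklyRegular_append_singleton_iff.2
      ⟨hgs.1.1, isSMulRegular_quotient_ofList_iff.1 hreg⟩
  · refine ne_top_of_le_ne_top hI (Ideal.span_le.2 fun g hg => ?_)
    rcases List.mem_append.1 hg with hg | hg
    · exact hmem g hg
    · rw [List.mem_singleton.1 hg]
      exact hhI

/-- If `I` contains a regular sequence of forms of degrees at most `d` that is longer than the
regular sequence `gs`, then some form of degree `d` in `I` extends `gs`. -/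
theorem exists_isSMulRegular_of_length_lt [Infinite k] {I : Ideal (MvPolynomial (Fin n) k)}
    {gs fs : List (MvPolynomial (Fin n) k)} {b : List ℕ}
    (hgs : IsWeaklyRegular (MvPolynomial (Fin n) k) gs) (hfs : IsRegularSeqOfForms fs b)
    (hfI : ∀ f ∈ fs, f ∈ I) (hlt : gs.length < fs.length) {d : ℕ} (hd : ∀ e ∈ b, e ≤ d) :
    ∃ h ∈ I, h.IsHomogeneous d ∧ IsSMulRegular
      (MvPolynomial (Fin n) k ⧸ (Ideal.ofList gs • ⊤ : Ideal (MvPolynomial (Fin n) k))) h := by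
  let M := MvPolynomial (Fin n) k ⧸ (Ideal.ofList gs • ⊤ : Ideal (MvPolynomial (Fin n) k))
  let W : Ideal (MvPolynomial (Fin n) k) → Submodule k (degreePart I d) := fun p =>
    (degreePart p d).comap (degreePart I d).subtype
  obtain ⟨v, hv⟩ := Submodule.exists_forall_notMem_of_finite (k := k) (E := degreePart I d)
    (s := W '' associatedPrimes (MvPolynomial (Fin n) k) M)
    ((associatedPrimes.finite (MvPolynomial (Fin n) k) M).image _) (by
      rintro ⟨p, hp, hWp⟩
      have hprime : p.IsPrime := hp.1
      obtain ⟨-, u, hu⟩ := isAssociatedPrime_iff.1 hp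
      have hmem : ∀ r, r ∈ p ↔ r • u = 0 := fun r => by
        rw [hu, Submodule.mem_colon_singleton, Submodule.mem_bot]
      have hu0 : u ≠ 0 := fun h0 => hprime.ne_top (by
        rw [Ideal.eq_top_iff_one, hmem, h0, smul_zero])
      have hgp : ∀ g ∈ gs, g ∈ p := by
        intro g hg
        rw [hmem]
        obtain ⟨u', rfl⟩ := Submodule.mkQ_surjective _ u
        rw [← map_smul]
        refine (Submodule.Quotient.mk_eq_zero _).2 ?_
        exact Submodule.smul_mem_smul (Ideal.subset_span hg) trivial
      obtain ⟨f, hf, hfp⟩ : ∃ f ∈ fs, f ∉ p := by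
        by_contra! hall
        have hbot := torsionBySet_quotient_eq_bot (K := p) hlt hgs hfs.1.1 hgp hall
        have : u ∈ Submodule.torsionBySet (MvPolynomial (Fin n) k) M
            (p : Set (MvPolynomial (Fin n) k)) :=
          (Submodule.mem_torsionBySet_iff _ _).2 fun r => (hmem r).1 r.2
        rw [hbot] at this
        exact hu0 this
      obtain ⟨l, hl⟩ : ∃ l, (X l : MvPolynomial (Fin n) k) ∉ p := by
        by_contra! hall
        exact hfp (irrelevant_le_iff.2 hall (hfs.mem_irrelevant f hf))
      obtain ⟨e, he, hfe⟩ := IsRegularSeqOfForms.exists_isHomogeneous hfs.2 f hf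
      have hhom : (f * X l ^ (d - e)).IsHomogeneous d := by
        have := hfe.mul (isHomogeneous_X_pow (R := k) l (d - e))
        rwa [Nat.add_sub_cancel' (hd e he)] at this
      have hW : (⟨⟨f * X l ^ (d - e), hhom⟩, Ideal.mul_mem_right _ _ (hfI f hf)⟩ :
          degreePart I d) ∈ W p := by rw [hWp]; exact Submodule.mem_top
      have hW' : f * X l ^ (d - e) ∈ p := hW
      rcases hprime.mem_or_mem hW' with h | h
      · exact hfp h
      · exact hl (hprime.mem_of_pow_mem _ h))
  refine ⟨v, v.2, v.1.2, isSMulRegular_of_forall_associatedPrimes fun p hp hvp => ?_⟩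
  exact hv _ ⟨p, hp, rfl⟩ hvp

/-- The degrees of a minimally contained regular sequence are bounded by those of any regular
sequence of forms ordered by degree. -/
theorem MinimallyContains.getElem_le [Infinite k] {I : Ideal (MvPolynomial (Fin n) k)}
    (hI : I ≠ ⊤) {a b : List ℕ} (hmin : MinimallyContains I a) (hb : b.Pairwise (· ≤ ·))
    (hcont : ContainsRegularSeq I b) {i : ℕ} (hia : i < a.length) (hib : i < b.length) :
    a[i] ≤ b[i] := by
  obtain ⟨fs, hfs, hfI⟩ := hcont
  have hlen := hfs.2.length_eq
  have hif : i < fs.length := by omega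
  rcases Nat.eq_zero_or_pos i with rfl | hi
  · exact (hmin.first hia).2 ⟨fs[0], hfI _ (List.getElem_mem hif),
      hfs.ne_zero (List.getElem_mem hif), hfs.isHomogeneous_getElem hif hib⟩
  · obtain ⟨⟨hs, hhs, hhI⟩, hleast⟩ := hmin.next i hia hi
    obtain ⟨gs, g, rfl, hgs, -⟩ := hhs.of_append_singleton
    have hgI : ∀ g ∈ gs, g ∈ I := fun g hg => hhI g (List.mem_append_left _ hg)
    have hfs' : IsRegularSeqOfForms (fs.take (i + 1)) (b.take (i + 1)) := by
      refine ⟨?_, List.forall₂_take _ hfs.2⟩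
      have := hfs.1
      rw [← List.take_append_drop (i + 1) fs] at this
      exact this.of_append_left
    have hgl := hgs.2.length_eq
    rw [List.length_take] at hgl
    obtain ⟨h, hhI', hhd, hreg⟩ := exists_isSMulRegular_of_length_lt (d := b[i]) hgs.1.1 hfs'
      (fun f hf => hfI f (List.mem_of_mem_take hf)) (by rw [List.length_take]; omega) (by
        intro e he
        obtain ⟨j, hj, rfl⟩ := List.getElem_of_mem he
        rw [List.getElem_take]
        rw [List.length_take] at hj
        rcases eq_or_lt_of_le (show j ≤ i by omega) with rfl | hji
        · exact le_rfl
        · exact List.pairwise_iff_getElem.1 hb j i _ _ hji)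
    refine hleast ⟨gs ++ [h], hgs.append_singleton hI hgI hhd hhI' hreg, fun f hf => ?_⟩
    rcases List.mem_append.1 hf with hf | hf
    · exact hgI f hf
    · rw [List.mem_singleton.1 hf]
      exact hhI'

theorem MinimallyContains.containsRegularSeq {I : Ideal (MvPolynomial (Fin n) k)}
    (hI : I ≠ ⊤) {a : List ℕ} (hmin : MinimallyContains I a) : ContainsRegularSeq I a := by
  have hnil : IsRegularSeqOfForms ([] : List (MvPolynomial (Fin n) k)) [] :=
    ⟨IsRegular.nil _ _, .nil⟩
  rcases Nat.lt_or_ge 1 a.length with h | h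
  · have h1 := (hmin.next (a.length - 1) (by omega) (by omega)).1
    rwa [Set.mem_ofPred_eq, ← List.take_succ_eq_append_getElem (by omega),
      List.take_of_length_le (by omega)] at h1
  · match a, h with
    | [], _ => exact ⟨[], hnil, by simp⟩
    | [d], _ =>
      obtain ⟨f, hfI, hf0, hfd⟩ := (hmin.first (by simp)).1
      refine ⟨[] ++ [f], hnil.append_singleton hI (by simp) hfd hfI ?_, by simpa using hfI⟩
      rw [isSMulRegular_quotient_ofList_iff]
      intro g hg
      simpa [hf0] using hg

/-- A regular sequence of forms in a complete intersection, ordered by degree, has degrees bounded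
below by the sorted degrees of the generators. -/
theorem sort_le_of_mem_ofList {fs gs : List (MvPolynomial (Fin n) k)} {b c : Fin n → ℕ}
    (hfs : IsRegularSeqOfForms fs (List.ofFn c)) (hgs : IsRegularSeqOfForms gs (List.ofFn b))
    (hb : Monotone b) (hmem : ∀ g ∈ gs, g ∈ Ideal.ofList fs) (i : Fin n) :
    c (Tuple.sort c i) ≤ b i := by
  by_contra! hlt
  have hfl : fs.length = n := by simpa using hfs.2.length_eq
  have hgl : gs.length = n := by simpa using hgs.2.length_eq
  let T : Set (MvPolynomial (Fin n) k) := {g | g ∈ fs ∧ ∃ e ≤ b i, g.IsHomogeneous e}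
  have hT : T ⊆ (fun j : Fin n => fs[Tuple.sort c j]'(by omega)) '' Set.Iio i := by
    rintro g ⟨hg, e, he, hge⟩
    obtain ⟨j, hj, rfl⟩ := List.getElem_of_mem hg
    have hcj := hfs.isHomogeneous_getElem hj (by simpa using hfl ▸ hj)
    rw [List.getElem_ofFn] at hcj
    have hc : c ⟨j, hfl ▸ hj⟩ = e := hcj.inj_right hge (hfs.ne_zero hg)
    refine ⟨(Tuple.sort c).symm ⟨j, hfl ▸ hj⟩, ?_, by simp⟩
    by_contra hnot
    rw [Set.mem_Iio, not_lt] at hnot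
    have := Tuple.monotone_sort c hnot
    simp only [Function.comp_apply, Equiv.apply_symm_apply] at this
    omega
  have hfin : ((fun j : Fin n => fs[Tuple.sort c j]'(by omega)) '' Set.Iio i).Finite :=
    Set.toFinite _
  have hcard : T.ncard ≤ i := by
    refine (Set.ncard_le_ncard hT hfin).trans ((Set.ncard_image_le (Set.toFinite _)).trans ?_)
    rw [Set.ncard_eq_toFinset_card', Set.toFinset_Iio, Fin.card_Iio]
  have htop : Ideal.span T ≠ ⊤ := ne_top_of_le_ne_top (isRegular_self_iff.1 hfs.1).2
    (Ideal.span_mono fun g hg => hg.1)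
  have hheight : (Ideal.span T).height ≤ (i : ℕ) := by
    refine (Ideal.height_le_spanFinrank _ htop).trans ?_
    exact_mod_cast (Submodule.spanFinrank_span_le_ncard_of_finite (hfin.subset hT)).trans hcard
  have hreg : IsWeaklyRegular (MvPolynomial (Fin n) k) (gs.take (i + 1)) := by
    have := hgs.1.1
    rw [← List.take_append_drop (i + 1) gs, isWeaklyRegular_append_iff] at this
    exact this.1
  have hle := Ideal.length_le_height_of_isWeaklyRegular hreg (I := Ideal.span T) (by
    intro g hg
    obtain ⟨j, hj, rfl⟩ := List.getElem_of_mem hg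
    rw [List.getElem_take]
    rw [List.length_take] at hj
    have hjn : j < n := by omega
    have hgj := hgs.isHomogeneous_getElem (i := j) (by omega) (by simpa using hjn)
    rw [List.getElem_ofFn] at hgj
    rw [← homogeneousComponent_eq_self hgj]
    refine Ideal.span_mono ?_ (homogeneousComponent_mem_span (fun f hf =>
      let ⟨d, _, hd⟩ := IsRegularSeqOfForms.exists_isHomogeneous hfs.2 f hf
      ⟨d, hd⟩) (hmem _ (List.getElem_mem _)) _)
    rintro f ⟨hf, e, he, hfe⟩
    exact ⟨hf, e, he.trans (hb (show (⟨j, hjn⟩ : Fin n) ≤ i from Fin.le_def.2 (by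
      simp only; omega))), hfe⟩)
  have h := hle.trans hheight
  rw [List.length_take, min_eq_left (by omega)] at h
  have : ((i : ℕ) + 1) ≤ (i : ℕ) := by exact_mod_cast h
  omega

end Liaison

namespace Liaison

open MvPolynomial RingTheory.Sequence

variable {k : Type*} [Field k] {n : ℕ}

theorem IsProperHomogeneousOfHeight.isGraded {r : ℕ} {I : Ideal (MvPolynomial (Fin n) k)}
    (h : IsProperHomogeneousOfHeight r I) : IsGraded I :=
  fun _ hf d => homogeneousComponent_mem_of_mem h.2.1 hf d

/-- There is a monomial ideal containing the powers `x_i^{b_i}` with the Hilbert function of `I`. -/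
def HasMonomialModel (I : Ideal (MvPolynomial (Fin n) k)) (b : Fin n → ℕ) : Prop :=
  ∃ M : Ideal (MvPolynomial (Fin n) k), IsMonomialIdeal M ∧ (∀ i, X i ^ b i ∈ M) ∧
    ∀ d, hilbertFunction M d = hilbertFunction I d

theorem height_le_of_ne_top {I : Ideal (MvPolynomial (Fin n) k)} (hI : I ≠ ⊤) :
    I.height ≤ (n : ℕ∞) := by
  have h := Ideal.height_le_ringKrullDim_of_ne_top hI
  rw [MvPolynomial.ringKrullDim_of_isNoetherianRing, ringKrullDim_eq_zero_of_field, zero_add,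
    Nat.card_fin] at h
  exact_mod_cast h

theorem IsCI.hasMonomialModel {I : Ideal (MvPolynomial (Fin n) k)} (hCI : IsCI I) {b : Fin n → ℕ}
    (hb : Monotone b) (hcont : ContainsRegularSeq I (List.ofFn b)) : HasMonomialModel I b := by
  obtain ⟨fs, c, hfs, rfl⟩ := hCI
  obtain ⟨gs, hgs, hmem⟩ := hcont
  have htop := (isRegular_self_iff.1 hfs.1).2
  have hgl : gs.length = n := by simpa using hgs.2.length_eq
  have hlen : c.length = n := by
    rw [← hfs.2.length_eq]
    refine le_antisymm ?_ ?_
    · have h := (Ideal.length_le_height_of_isWeaklyRegular hfs.1.1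
        (I := Ideal.ofList fs) fun f hf => Ideal.subset_span hf).trans (height_le_of_ne_top htop)
      exact_mod_cast h
    · have h1 := Ideal.length_le_height_of_isWeaklyRegular hgs.1.1 hmem
      have h2 : Submodule.spanFinrank (Ideal.ofList fs) ≤ fs.length := by
        classical
        have hset : {f | f ∈ fs} = (fs.toFinset : Set (MvPolynomial (Fin n) k)) := by ext; simp
        refine (Submodule.spanFinrank_span_le_ncard_of_finite
          (hset ▸ Finset.finite_toSet _)).trans ?_
        rw [hset, Set.ncard_coe_finset]
        exact fs.toFinset_card_le
      have h3 := (h1.trans (Ideal.height_le_spanFinrank _ htop)).trans (Nat.cast_le.2 h2)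
      rw [hgl] at h3
      exact_mod_cast h3
  obtain ⟨c, rfl⟩ : ∃ c' : Fin n → ℕ, c = List.ofFn c' := by
    subst hlen
    exact ⟨c.get, (List.ofFn_get c).symm⟩
  refine ⟨Ideal.ofList (List.ofFn fun j => X ((Tuple.sort c).symm j) ^ c j),
    isMonomialIdeal_ofList_ofFn_X_pow _ _, fun i => ?_, fun d => ?_⟩
  · refine Ideal.mem_of_dvd _ (pow_dvd_pow _ (sort_le_of_mem_ofList hfs hgs hb hmem i))
      (Ideal.subset_span ((List.mem_ofFn' _ _).2 ⟨Tuple.sort c i, ?_⟩))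
    simp
  · exact hilbertFunction_eq_of_isRegularSeqOfForms
      (isRegularSeqOfForms_ofFn_X_pow hfs.pos_ofFn _) hfs d

theorem IsMinimalLink.hasMonomialModel [Infinite k] {J I I' : Ideal (MvPolynomial (Fin n) k)}
    (hlink : IsMinimalLink n J I I')
    (hI' : ∀ a : Fin n → ℕ, Monotone a → ContainsRegularSeq I' (List.ofFn a) →
      HasMonomialModel I' a)
    {b : Fin n → ℕ} (hb : Monotone b) (hcont : ContainsRegularSeq I (List.ofFn b)) :
    HasMonomialModel I b := by
  obtain ⟨hdir, a, hlen, hmin, hsort, gs, hgs, rfl⟩ := hlink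
  obtain ⟨a, rfl⟩ : ∃ a' : Fin n → ℕ, a = List.ofFn a' := by
    subst hlen
    exact ⟨a.get, (List.ofFn_get a).symm⟩
  have ha : Monotone a := List.sortedLE_ofFn_iff.1 hsort.sortedLE
  have hle := le_inf_iff.1 hdir.le
  obtain ⟨M, hM, hXM, hHM⟩ := hI' a ha ⟨gs, hgs, fun g hg => hle.2 (Ideal.subset_span hg)⟩
  have hX := isRegularSeqOfForms_ofFn_X_pow (k := k) hgs.pos_ofFn (Equiv.refl (Fin n))
  have hXmon := isMonomialIdeal_ofList_ofFn_X_pow (k := k) a (Equiv.refl (Fin n))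
  refine ⟨_, hXmon.colon hM, fun i => ?_, fun d => ?_⟩
  · have hab : a i ≤ b i := by
      have := hmin.getElem_le hdir.left.1 (hb.sortedLE_ofFn).pairwise hcont
        (i := i) (by simp) (by simp)
      simpa using this
    refine Ideal.mem_of_dvd _ (pow_dvd_pow _ hab) (Submodule.mem_colon.2 fun f _ => ?_)
    exact Ideal.mul_mem_right _ _ (Ideal.subset_span ((List.mem_ofFn' _ _).2 ⟨i, rfl⟩))
  · rw [hdir.left_eq]
    refine hilbertFunction_colon_eq hX hgs hM.isGraded hdir.right.isGraded ?_ hle.2 hHM d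
    refine Ideal.span_le.2 fun f hf => ?_
    obtain ⟨i, rfl⟩ := (List.mem_ofFn' _ _).1 hf
    exact hXM i

theorem hasMonomialModel_of_minimalLinks [Infinite k] (s : ℕ) :
    ∀ L : ℕ → Ideal (MvPolynomial (Fin n) k), IsCI (L s) →
      (∀ i < s, ∃ J, IsMinimalLink n J (L i) (L (i + 1))) →
      ∀ b : Fin n → ℕ, Monotone b → ContainsRegularSeq (L 0) (List.ofFn b) →
        HasMonomialModel (L 0) b := by
  induction s with
  | zero => exact fun L hCI _ b hb hcont => hCI.hasMonomialModel hb hcont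
  | succ s ih =>
    intro L hCI hlinks b hb hcont
    obtain ⟨J, hJ⟩ := hlinks 0 (Nat.succ_pos s)
    exact hJ.hasMonomialModel
      (ih (fun i => L (i + 1)) hCI fun i hi => hlinks (i + 1) (Nat.succ_lt_succ hi)) hb hcont

theorem IsMinimallyLicci.hasMonomialModel [Infinite k] {I : Ideal (MvPolynomial (Fin n) k)}
    (hI : IsMinimallyLicci I) {e : Fin n → ℕ} (he : Monotone e)
    (hmin : MinimallyContains I (List.ofFn e)) : I ≠ ⊤ ∧ HasMonomialModel I e := by
  obtain ⟨r, C, hCI, s, L, rfl, rfl, hL, hlinks⟩ := hI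
  have htop := (hL 0 (Nat.zero_le s)).1
  refine ⟨htop, hasMonomialModel_of_minimalLinks s L hCI ?_ e he (hmin.containsRegularSeq htop)⟩
  intro i hi
  obtain ⟨J, hJ⟩ := hlinks 0 (by omega)
  obtain ⟨-, a, hlen, hmin', -⟩ := hJ
  have hr : (r : ℕ∞) = n := by
    rw [← hlen, ← hmin'.depth_eq, hmin.depth_eq, List.length_ofFn]
  have hrn : r = n := by exact_mod_cast hr
  exact hrn ▸ hlinks i hi

end Liaison

theorem corollary3p4 {k : Type*} [Field k] [Infinite k] (n : ℕ)
    (e : Fin n → ℕ) (he : ∀ i, 2 ≤ e i) (hmono : Monotone e)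
    (I : Ideal (MvPolynomial (Fin n) k))
    (hlicci : Liaison.IsMinimallyLicci I)
    (hmin : Liaison.MinimallyContains I (List.ofFn e)) :
    ∃ J : Ideal (MvPolynomial (Fin n) k),
      J ≠ ⊤ ∧ Liaison.IsMonomialIdeal J ∧
        (∀ i, (MvPolynomial.X i : MvPolynomial (Fin n) k) ^ e i ∈ J) ∧
        ∀ d : ℕ, Liaison.hilbertFunction J d = Liaison.hilbertFunction I d := by
  obtain ⟨htop, J, hJ, hX, hH⟩ := hlicci.hasMonomialModel hmono hmin
  refine ⟨J, ?_, hJ, hX, hH⟩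
  rintro rfl
  refine htop ((Ideal.eq_top_iff_one _).2 ?_)
  have h0 := hH 0
  rw [Liaison.hilbertFunction_eq_zero_iff.2 fun _ _ => Submodule.mem_top, eq_comm,
    Liaison.hilbertFunction_eq_zero_iff] at h0
  exact h0 1 (MvPolynomial.isHomogeneous_one _ _)
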